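/- Let $\mathsf X$ be a measurable space with $\sigma$-field $\mathcal X$, $\chi$ a probability measure and $M$ a Markov kernel on $\mathsf X$, $\mathsf Z$ a set, and $\{g\langle z\rangle : z\in\mathsf Z\}$ a family of measurable functions $g\langle z\rangle:\mathsf X\to\mathbb R$ such that $g\langle z\rangle(x)>0$ for all $x,z$ and $\|g\langle z\rangle\|_\infty<\infty$ for all $z$. Given $(z_k)_{k\ge0}$ in $\mathsf Z$ put $$Q_{k,m}(x_k,A)=\int\!\cdots\!\int \mathbf 1_A(x_m)\prod_{\ell=k}^{m-1} g\langle z_\ell\rangle(x_\ell)\,M(x_\ell,dx_{\ell+1})\quad(k<m),\qquad Q_{m,m}(x,A)=\delta_x(A),$$ $$\eta_m h=\frac{\chi Q_{0,m}h}{\chi Q_{0,m}\mathbf 1},\qquad \phi_n h=\frac{\chi Q_{0,n}(g\langle z_n\rangle h)}{\chi Q_{0,n}\,g\langle z_n\rangle},$$ and, for $0\le \ell\le n$ and bounded measurable $f,h:\mathsf X\to\mathbb R$, $$\sigma^2_{n,\ell}(f)=\sum_{m=\ell}^n\frac{\eta_m\{Q_{m,n}(f-\eta_n f)\}^2}{(\eta_m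 Q_{m,n}\mathbf 1)^2},\qquad \tilde\sigma^2_{n,\ell}(h)=\frac{\sigma^2_{n,\ell}\big(g\langle z_n\rangle\{h-\phi_n h\}\big)}{(\eta_n g\langle z_n\rangle)^2}.$$ For each $N\ge1$ run the particle filter with $N$ particles: $\xi_0^1,\dots,\xi_0^N$ are i.i.d. with law $\chi$, and at each time $m\geq 0$, conditionally on the particles and ancestor indices generated so far, draw independently for $i=1,\dots,N$ an index $I_{m+1}^i\in\{1,\dots,N\}$ with $\mathbb P(I_{m+1}^i=k)=\omega_m^k/\Omega_m$, where $\omega_m^k=g\langle z_m\rangle(\xi_m^k)$ and $\Omega_m=\sum_{k=1}^N\omega_m^k$, and then $\xi_{m+1}^i\sim M(\xi_m^{I_{m+1}^i},\cdot)$. Let $E_{m,m}^i=i$ and $E_{m,n}^i=E_{m,n-1}^{I_n^i}$ for $n>m$, so that $E_{m,n}^i$ is the index of the time-$m$ ancestor of $\xi_n^i$. Write $\eta_n^N f=\frac1N\sum_{i=1}^N f(\xi_n^i)$ and $\phi_n^N h=\sum_{i=1}^N\frac{\omega_n^i}{\Omega_n}h(\xi_n^i)$. For a lag $\lambda\in\mathbb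 N$ put $n\langle\lambda\rangle=\max(n-\lambda,0)$ and $$\hat\sigma^2_{N,n,\lambda}(f)=\frac1N\sum_{i=1}^N\Big(\sum_{j:\,E^j_{n\langle\lambda\rangle,n}=i}\{f(\xi_n^j)-\eta_n^N f\}\Big)^2,\qquad \tilde\sigma^2_{N,n,\lambda}(h)=\frac{\hat\sigma^2_{N,n,\lambda}\big(g\langle z_n\rangle\{h-\phi_n^N h\}\big)}{(\eta_n^N g\langle z_n\rangle)^2}.$$ Then for all $n\in\mathbb N$, $z_0,\dots,z_n\in\mathsf Z$, $\lambda\in\mathbb N$ and all bounded measurable $h:\mathsf X\to\mathbb R$, as $N\to\infty$, $$\tilde\sigma^2_{N,n,\lambda}(h)\ \longrightarrow\ \tilde\sigma^2_{n,\,n\langle\lambda\rangle}(h)\quad\text{in probability.}$$ -/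

import Mathlib

open MeasureTheory ProbabilityTheory Filter

noncomputable section

namespace FeynmanKac

section Model

/-! ### The perturbed Feynman-Kac model -/

variable {X Z : Type*} [MeasurableSpace X]

/-- The one-step unnormalised kernel `(x, A) ↦ ∫ 1_A(x') g⟨z⟩(x) M(x, dx') = g⟨z⟩(x) M(x, A)`. -/
def stepKernel (M : Kernel X X) [IsMarkovKernel M] (g : Z → X → ℝ) (z : Z) : Kernel X X :=
  Kernel.withDensity M (fun x _ => ENNReal.ofReal (g z x))

/-- The unnormalised kernel `Q⟨z_k, …, z_{m-1}⟩`, i.e. the composition of the one-step kernels with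
perturbations `z_k, …, z_{m-1}`; it is the identity kernel `(x, A) ↦ δ_x(A)` if `m ≤ k`.
The right end `m` of the index interval is excluded. -/
def unnormKernel (M : Kernel X X) [IsMarkovKernel M] (g : Z → X → ℝ) (z : ℕ → Z) (k : ℕ) :
    ℕ → Kernel X X
  | 0 => Kernel.id
  | m + 1 => if k ≤ m then stepKernel M g (z m) ∘ₖ unnormKernel M g z k m else Kernel.id

/-- The measure `A ↦ μ(A) / μ(E)`. -/
def normalise (μ : Measure X) : Measure X := (μ Set.univ)⁻¹ • μ

/-- The Feynman-Kac flow `η_n = η⟨z_0, …, z_{n-1}⟩`, the normalisation of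
`χ Q⟨z_0, …, z_{n-1}⟩`; in particular `η_0 = χ`. -/
def pred (χ : Measure X) (M : Kernel X X) [IsMarkovKernel M] (g : Z → X → ℝ) (z : ℕ → Z) (n : ℕ) :
    Measure X :=
  normalise (χ.bind (unnormKernel M g z 0 n))

/-- The updated flow `φ_n = φ⟨z_0, …, z_n⟩`, the normalisation of
`A ↦ χ Q⟨z_0, …, z_{n-1}⟩(g⟨z_n⟩ 1_A)`. -/
def filt (χ : Measure X) (M : Kernel X X) [IsMarkovKernel M] (g : Z → X → ℝ) (z : ℕ → Z) (n : ℕ) :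
    Measure X :=
  normalise ((χ.bind (unnormKernel M g z 0 n)).withDensity (fun x => ENNReal.ofReal (g (z n) x)))

/-- The truncated asymptotic variance
`σ²_ℓ⟨z_0, …, z_{n-1}⟩(h) =
  ∑_{m = ℓ}^n η_m {Q⟨z_m, …, z_{n-1}⟩ (h - η_n h)}² / (η_m Q⟨z_m, …, z_{n-1}⟩ 1)²`. -/
def asVar (χ : Measure X) (M : Kernel X X) [IsMarkovKernel M] (g : Z → X → ℝ) (z : ℕ → Z)
    (ℓ n : ℕ) (h : X → ℝ) : ℝ :=
  ∑ m ∈ Finset.Icc ℓ n,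
    (∫ x, (∫ y, (h y - ∫ u, h u ∂(pred χ M g z n)) ∂(unnormKernel M g z m n x)) ^ 2
        ∂(pred χ M g z m))
      / (∫ x, (∫ _, (1 : ℝ) ∂(unnormKernel M g z m n x)) ∂(pred χ M g z m)) ^ 2

/-- The truncated asymptotic variance of the updated flow,
`σ̃²_ℓ⟨z_0, …, z_n⟩(h) = σ²_ℓ⟨z_0, …, z_{n-1}⟩(g⟨z_n⟩ {h - φ_n h}) / (η_n g⟨z_n⟩)²`. -/
def asVarFilt (χ : Measure X) (M : Kernel X X) [IsMarkovKernel M] (g : Z → X → ℝ) (z : ℕ → Z)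
    (ℓ n : ℕ) (h : X → ℝ) : ℝ :=
  asVar χ M g z ℓ n (fun x => g (z n) x * (h x - ∫ u, h u ∂(filt χ M g z n)))
    / (∫ x, g (z n) x ∂(pred χ M g z n)) ^ 2

end Model

section ParticleFilter

/-! ### The particle filter -/

variable {X Z Ω : Type*} [MeasurableSpace X] {N : ℕ}

/-- The σ-field generated by the particles at times `0, …, m` and the ancestor indices drawn at
times `1, …, m`. -/
@[reducible]
def history (ξ : ℕ → Ω → Fin N → X) (I : ℕ → Ω → Fin N → Fin N) (m : ℕ) : MeasurableSpace Ω :=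
  (⨆ j ∈ Set.Iic m, MeasurableSpace.comap (ξ j) inferInstance) ⊔
    (⨆ j ∈ Set.Icc 1 m, MeasurableSpace.comap (I j) inferInstance)

/-- `ξ m ω i` and `I m ω i` are the particles at times `m ≤ T` and the ancestor indices at times
`1 ≤ m ≤ T` produced by the particle filter with `N` particles run up to time `T` along the
perturbations `z_0, …, z_{T-1}`. The initial particles are i.i.d. with law `χ`. For each `m < T`,
conditionally on the history up to time `m`, the pairs `(I_{m+1}^i, ξ_{m+1}^i)`, `i = 1, …, N`, are
independent, `I_{m+1}^i` has the categorical law with weights proportional to `g⟨z_m⟩(ξ_m^ℓ)`, and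
given `I_{m+1}^i = k` the particle `ξ_{m+1}^i` has law `M(ξ_m^k, ·)`. -/
structure IsParticleFilter [MeasurableSpace Ω] (P : Measure Ω) (χ : Measure X) (M : Kernel X X)
    (g : Z → X → ℝ) (z : ℕ → Z) (T : ℕ)
    (ξ : ℕ → Ω → Fin N → X) (I : ℕ → Ω → Fin N → Fin N) : Prop where
  measurable_particle : ∀ m ≤ T, Measurable (ξ m)
  measurable_index : ∀ m, 1 ≤ m → m ≤ T → Measurable (I m)
  initial : P.map (ξ 0) = Measure.pi (fun _ : Fin N => χ)
  transition : ∀ m < T, ∀ A : Set Ω, MeasurableSet[history ξ I m] A →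
    ∀ (k : Fin N → Fin N) (B : Fin N → Set X), (∀ i, MeasurableSet (B i)) →
      P (A ∩ {ω | ∀ i, I (m + 1) ω i = k i ∧ ξ (m + 1) ω i ∈ B i}) =
        ∫⁻ ω in A, ∏ i : Fin N,
          (ENNReal.ofReal (g (z m) (ξ m ω (k i)) / ∑ l : Fin N, g (z m) (ξ m ω l))
            * M (ξ m ω (k i)) (B i)) ∂P

end ParticleFilter

section Estimators

/-! ### The variance estimators -/

variable {X : Type*} {N : ℕ}

/-- The Enoch index: `enoch I m n i` is the index of the ancestor at time `m` of particle `i` at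
time `n ≥ m`. -/
def enoch (I : ℕ → Fin N → Fin N) (m : ℕ) : ℕ → Fin N → Fin N
  | 0, i => i
  | n + 1, i => if n + 1 ≤ m then i else enoch I m n (I (n + 1) i)

/-- The empirical mean `η_n^N h = N⁻¹ ∑_i h(x^i)` of the particles `x^1, …, x^N`. -/
def predPart (x : Fin N → X) (h : X → ℝ) : ℝ := (1 / (N : ℝ)) * ∑ i, h (x i)

/-- The weighted empirical mean `φ_n^N h = ∑_i (w^i / ∑_l w^l) h(x^i)`, where `w^i = w(x^i)`. -/
def filtPart (w : X → ℝ) (x : Fin N → X) (h : X → ℝ) : ℝ :=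
  ∑ i, w (x i) / (∑ l, w (x l)) * h (x i)

/-- The fixed-lag variance estimator with lag `lag` at time `n`, where `x` are the particles at time
`n` and `I` the ancestor indices; truncated subtraction gives `n - lag = max (n - lag) 0`. -/
def varEst (I : ℕ → Fin N → Fin N) (n lag : ℕ) (x : Fin N → X) (h : X → ℝ) : ℝ :=
  (1 / (N : ℝ)) * ∑ i : Fin N,
    (∑ j ∈ Finset.univ.filter (fun j => enoch I (n - lag) n j = i), (h (x j) - predPart x h)) ^ 2

/-- The fixed-lag variance estimator for the updated flow, where `w` is the potential at
time `n`. -/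
def varEstFilt (w : X → ℝ) (I : ℕ → Fin N → Fin N) (n lag : ℕ) (x : Fin N → X) (h : X → ℝ) : ℝ :=
  varEst I n lag x (fun y => w y * (h y - filtPart w x h)) / (predPart x w) ^ 2

end Estimators

end FeynmanKac

end

/-! Fix the ancestral time l = n - lag. For a fixed test function f let V_m(f) (`lineageVar`) be 1/N
times the sum, over the ancestors i at time l, of the squared sum of f over the descendants of i at
time m. The core is `tendstoInMeasure_lineageVar`: V_m(f) converges in probability to S_m(f)
(`asVarUncentred`), by induction on m starting at l, for all bounded measurable f at once.

Given the particles at time m and their ancestors at time l, the pairs (ancestor index, particle) of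
generation m+1 are i.i.d. (`map_genealogy_generation`), so V_{m+1}(f) is a quadratic statistic of an
i.i.d. sample in which two particles interact only if they belong to the same family. The diagonal
and the off-diagonal pairs give the conditional mean φ_m^N(M f²) + (1 - 1/N) V_m(g M f) / (η_m^N
g)². By the law of large numbers (`tendstoInMeasure_predPart`) and the induction hypothesis at g M
f, this tends to η_{m+1} f² + S_m(g M f) / (η_m g)², which is S_{m+1}(f) by `asVarUncentred_succ`.

The Hoeffding decomposition (`integral_quadratic_sub_sq_le`, `integral_classSum_sub_sq_le`) bounds
the conditional variance in terms of N and the probability Q that two independent draws fall in the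
same family. Since Q = V_m(g) / (N (η_m^N g)²) is itself a lineage statistic, the induction
hypothesis at g makes it of order 1/N in probability, and the variance bound vanishes. A conditional
Chebyshev inequality (`measure_ge_le`) then suffices: the variance bound need only vanish in
probability, so no moments of family sizes are estimated.

The test function g(h - φ_n^N h) of the estimator is random, but its empirical mean is zero, so the
estimator equals V_n(gh - c g) / (η_n^N g)² with c = φ_n^N h. As V_n is a quadratic form, it expands
into its values at the fixed functions gh, gh + g and g with coefficients polynomial in c, and the
continuous mapping theorem concludes. -/

namespace FeynmanKac

/-! ### Bounded measurable functions -/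

/-- A real function is bounded and measurable. -/
structure BddMeas {α : Type*} [MeasurableSpace α] (f : α → ℝ) : Prop where
  meas : Measurable f
  bdd : ∃ C : ℝ, ∀ x, |f x| ≤ C

namespace BddMeas

variable {α β : Type*} [MeasurableSpace α] [MeasurableSpace β] {f f' : α → ℝ}

lemma integrable (hf : BddMeas f) (μ : Measure α) [IsFiniteMeasure μ] : Integrable f μ := by
  obtain ⟨C, hC⟩ := hf.bdd
  exact Integrable.of_bound hf.meas.aestronglyMeasurable C (Eventually.of_forall hC)

lemma const (c : ℝ) : BddMeas (fun _ : α => c) := ⟨measurable_const, |c|, fun _ => le_rfl⟩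

lemma add (hf : BddMeas f) (hf' : BddMeas f') : BddMeas (fun x => f x + f' x) := by
  obtain ⟨C, hC⟩ := hf.bdd
  obtain ⟨D, hD⟩ := hf'.bdd
  exact ⟨hf.meas.add hf'.meas, C + D, fun x => (abs_add_le _ _).trans (add_le_add (hC x) (hD x))⟩

lemma mul (hf : BddMeas f) (hf' : BddMeas f') : BddMeas (fun x => f x * f' x) := by
  obtain ⟨C, hC⟩ := hf.bdd
  obtain ⟨D, hD⟩ := hf'.bdd
  refine ⟨hf.meas.mul hf'.meas, C * D, fun x => ?_⟩
  rw [abs_mul]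
  exact mul_le_mul (hC x) (hD x) (abs_nonneg _) ((abs_nonneg _).trans (hC x))

lemma const_mul (hf : BddMeas f) (c : ℝ) : BddMeas (fun x => c * f x) := (const c).mul hf

lemma sub (hf : BddMeas f) (hf' : BddMeas f') : BddMeas (fun x => f x - f' x) := by
  simpa [sub_eq_add_neg] using hf.add (hf'.const_mul (-1))

lemma sq (hf : BddMeas f) : BddMeas (fun x => f x ^ 2) := by
  simpa [_root_.sq] using hf.mul hf

lemma comp (hf : BddMeas f) {u : β → α} (hu : Measurable u) : BddMeas (fun y => f (u y)) := by
  obtain ⟨C, hC⟩ := hf.bdd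
  exact ⟨hf.meas.comp hu, C, fun y => hC _⟩

lemma sum {ι : Type*} {s : Finset ι} {F : ι → α → ℝ} (hF : ∀ i, BddMeas (F i)) :
    BddMeas (fun x => ∑ i ∈ s, F i x) := by
  classical
  induction s using Finset.induction_on with
  | empty => simpa using const 0
  | insert i s hi ih => simpa [Finset.sum_insert hi] using (hF i).add ih

lemma ite (hf : BddMeas f) {s : Set α} (hs : MeasurableSet s) [DecidablePred (· ∈ s)] :
    BddMeas (fun x => if x ∈ s then f x else 0) := by
  obtain ⟨C, hC⟩ := hf.bdd
  refine ⟨Measurable.ite hs hf.meas measurable_const, C, fun x => ?_⟩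
  split_ifs
  · exact hC x
  · simpa using (abs_nonneg _).trans (hC x)

lemma integral_kernel (hf : BddMeas f) (κ : Kernel β α) [IsFiniteKernel κ] :
    BddMeas (fun y => ∫ x, f x ∂(κ y)) := by
  obtain ⟨C, hC⟩ := hf.bdd
  refine ⟨(hf.meas.stronglyMeasurable.integral_kernel (κ := κ)).measurable,
    C * κ.bound.toReal, fun y => ?_⟩
  -- On an empty space the constant C may be negative, so that case is separated.
  have hC0 : 0 ≤ C ∨ IsEmpty α := by
    rcases isEmpty_or_nonempty α with h | ⟨⟨a⟩⟩
    · exact Or.inr h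
    · exact Or.inl ((abs_nonneg _).trans (hC a))
  rcases hC0 with hC0 | hα
  · refine (norm_integral_le_of_norm_le_const (f := f) (C := C)
      (Eventually.of_forall fun x => by simpa using hC x)).trans ?_
    exact mul_le_mul_of_nonneg_left
      (ENNReal.toReal_mono κ.bound_ne_top (κ.measure_le_bound y Set.univ)) hC0
  · simp [Measure.eq_zero_of_isEmpty (κ y)]

lemma integral_right {F : α → β → ℝ} (hF : BddMeas (Function.uncurry F)) (μ : Measure β)
    [IsProbabilityMeasure μ] : BddMeas (fun a => ∫ b, F a b ∂μ) := by
  obtain ⟨C, hC⟩ := hF.bdd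
  refine ⟨hF.meas.stronglyMeasurable.integral_prod_right.measurable, C, fun a => ?_⟩
  simpa using norm_integral_le_of_norm_le_const (μ := μ) (f := F a) (C := C)
    (Eventually.of_forall fun b => by simpa using hC (a, b))

end BddMeas

lemma integral_sub_integral_sq_le {α : Type*} [MeasurableSpace α] {μ : Measure α}
    [IsProbabilityMeasure μ] {f : α → ℝ} (hf : BddMeas f) :
    ∫ x, (f x - ∫ y, f y ∂μ) ^ 2 ∂μ ≤ ∫ x, f x ^ 2 ∂μ := by
  set c := ∫ y, f y ∂μ with hc
  have h1 : ∀ x, (f x - c) ^ 2 = f x ^ 2 - 2 * c * f x + c ^ 2 := fun x => by ring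
  simp_rw [h1]
  rw [integral_add ((hf.sq.sub (hf.const_mul _)).integrable μ) (integrable_const _),
    integral_sub (hf.sq.integrable μ) ((hf.const_mul _).integrable μ), integral_const_mul, ← hc]
  simp
  nlinarith [sq_nonneg c]

/-! ### Second moments of statistics of an i.i.d. sample -/

lemma integral_sum_sq_of_orthogonal {α P : Type*} [MeasurableSpace α] {μ : Measure α}
    [IsFiniteMeasure μ] [DecidableEq P] (s : Finset P) {T : P → α → ℝ} (hT : ∀ p, BddMeas (T p))
    (h : ∀ p ∈ s, ∀ p' ∈ s, p ≠ p' → ∫ x, T p x * T p' x ∂μ = 0) :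
    ∫ x, (∑ p ∈ s, T p x) ^ 2 ∂μ = ∑ p ∈ s, ∫ x, T p x ^ 2 ∂μ := by
  simp_rw [sq, Finset.sum_mul_sum]
  rw [integral_finsetSum _ fun p _ => (BddMeas.sum fun p' => (hT p).mul (hT p')).integrable μ]
  refine Finset.sum_congr rfl fun p hp => ?_
  rw [integral_finsetSum _ fun p' _ => ((hT p).mul (hT p')).integrable μ]
  exact Finset.sum_eq_single p (fun p' hp' hne => h p hp p' hp' hne.symm) fun hp' => absurd hp hp'

section Sample

variable {S : Type*} [MeasurableSpace S] {N : ℕ} {μ : Measure S} [IsProbabilityMeasure μ]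

/-- Resampling one coordinate of an i.i.d. sample does not change its law. This makes it possible to
integrate out one coordinate with the others frozen, without splitting the product space. -/
lemma measurePreserving_update (k : Fin N) :
    MeasurePreserving (fun p : (Fin N → S) × S => Function.update p.1 k p.2)
      ((Measure.pi fun _ : Fin N => μ).prod μ) (Measure.pi fun _ : Fin N => μ) := by
  have hm : Measurable (fun p : (Fin N → S) × S => Function.update p.1 k p.2) := by
    refine measurable_pi_lambda _ fun i => ?_
    by_cases h : i = k
    · subst h; simpa using measurable_snd
    · simp only [Function.update_of_ne h]
      exact (measurable_pi_apply i).comp measurable_fst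
  refine ⟨hm, (Measure.pi_eq fun s hs => ?_).symm⟩
  rw [Measure.map_apply hm (MeasurableSet.univ_pi hs)]
  have : (fun p : (Fin N → S) × S => Function.update p.1 k p.2) ⁻¹' (Set.univ.pi s)
      = (Set.univ.pi (Function.update s k Set.univ)) ×ˢ (s k) := by
    ext p
    simp only [Set.mem_preimage, Set.mem_pi, Set.mem_univ, forall_true_left, Set.mem_prod]
    constructor
    · intro h
      refine ⟨fun i => ?_, by simpa using h k⟩
      by_cases hi : i = k
      · subst hi; simp
      · simpa [Function.update_of_ne hi] using h i
    · rintro ⟨h, hk⟩ i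
      by_cases hi : i = k
      · subst hi; simpa using hk
      · simpa [Function.update_of_ne hi] using h i
  rw [this, Measure.prod_prod, Measure.pi_pi, ← Finset.mul_prod_erase _ _ (Finset.mem_univ k),
    ← Finset.mul_prod_erase (Finset.univ) (fun i => μ (s i)) (Finset.mem_univ k)]
  simp only [Function.update_self, measure_univ, one_mul]
  rw [mul_comm]
  congr 1
  exact Finset.prod_congr rfl fun i hi => by rw [Function.update_of_ne (Finset.ne_of_mem_erase hi)]

lemma integral_pi_eq_update {F : (Fin N → S) → ℝ} (hF : BddMeas F) (k : Fin N) :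
    ∫ y, F y ∂(Measure.pi fun _ : Fin N => μ)
      = ∫ y, ∫ u, F (Function.update y k u) ∂μ ∂(Measure.pi fun _ : Fin N => μ) := by
  have hp := measurePreserving_update (μ := μ) k
  rw [← hp.map_eq, integral_map hp.measurable.aemeasurable hF.meas.aestronglyMeasurable, hp.map_eq]
  exact integral_prod _ ((hF.comp hp.measurable).integrable _)

/-- The source of all orthogonality relations below: it is enough that integrating out a single
coordinate gives zero. -/
lemma integral_pi_eq_zero {F : (Fin N → S) → ℝ} (hF : BddMeas F) (k : Fin N)
    (h : ∀ y, ∫ u, F (Function.update y k u) ∂μ = 0) :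
    ∫ y, F y ∂(Measure.pi fun _ : Fin N => μ) = 0 := by
  rw [integral_pi_eq_update hF k]
  simp [h]

lemma integral_pi_eval {f : S → ℝ} (hf : BddMeas f) (j : Fin N) :
    ∫ y, f (y j) ∂(Measure.pi fun _ : Fin N => μ) = ∫ u, f u ∂μ := by
  rw [integral_pi_eq_update (F := fun y => f (y j)) (hf.comp (measurable_pi_apply j)) j]
  simp

lemma integral_pi_eval_pair {G : S → S → ℝ} (hG : BddMeas (Function.uncurry G)) {j k : Fin N}
    (hjk : j ≠ k) :
    ∫ y, G (y j) (y k) ∂(Measure.pi fun _ : Fin N => μ) = ∫ u, ∫ v, G u v ∂μ ∂μ := by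
  have hF : BddMeas (fun y : Fin N → S => G (y j) (y k)) :=
    hG.comp (u := fun y : Fin N → S => (y j, y k)) (by fun_prop)
  rw [integral_pi_eq_update hF k]
  simp only [Function.update_of_ne hjk, Function.update_self]
  exact integral_pi_eval (f := fun u => ∫ v, G u v ∂μ) (hG.integral_right μ) j

/-- The empirical mean of an i.i.d. sample has variance at most `∫ φ² / N`. -/
lemma integral_mean_sub_sq_le {φ : S → ℝ} (hφ : BddMeas φ) (hN : 1 ≤ N) :
    ∫ y, ((1 / (N : ℝ)) * ∑ j, φ (y j) - ∫ u, φ u ∂μ) ^ 2 ∂(Measure.pi fun _ : Fin N => μ)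
      ≤ (1 / (N : ℝ)) * ∫ u, φ u ^ 2 ∂μ := by
  have hN' : (N : ℝ) ≠ 0 := by positivity
  set c := ∫ u, φ u ∂μ with hc
  have h1 : ∀ y : Fin N → S, ((1 / (N : ℝ)) * ∑ j, φ (y j) - c) ^ 2
      = (1 / (N : ℝ)) ^ 2 * (∑ j, (φ (y j) - c)) ^ 2 := by
    intro y
    rw [Finset.sum_sub_distrib, ← mul_pow]
    congr 1
    simp
    field_simp
  have hT : ∀ j : Fin N, BddMeas (fun y : Fin N → S => φ (y j) - c) := fun j =>
    (hφ.comp (measurable_pi_apply j)).sub (BddMeas.const c)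
  simp_rw [h1]
  rw [integral_const_mul, integral_sum_sq_of_orthogonal _ hT]
  · have h2 : ∀ j : Fin N, ∫ y, (φ (y j) - c) ^ 2 ∂(Measure.pi fun _ : Fin N => μ)
        ≤ ∫ u, φ u ^ 2 ∂μ := fun j => by
      rw [integral_pi_eval (f := fun u => (φ u - c) ^ 2) (hφ.sub (BddMeas.const c)).sq j]
      exact integral_sub_integral_sq_le hφ
    calc _ ≤ (1 / (N : ℝ)) ^ 2 * ∑ _j : Fin N, ∫ u, φ u ^ 2 ∂μ := by
          gcongr; exact h2 _
      _ = _ := by simp; field_simp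
  · intro j _ k _ hjk
    refine integral_pi_eq_zero ((hT j).mul (hT k)) k fun y => ?_
    simp only [Function.update_of_ne hjk, Function.update_self]
    rw [integral_const_mul, integral_sub (hφ.integrable μ) (integrable_const _)]
    simp [hc]

lemma sum_sum_eq_diag_add_two_mul (a : Fin N → Fin N → ℝ) (ha : ∀ i j, a i j = a j i) :
    ∑ i, ∑ j, a i j = ∑ i, a i i
      + 2 * ∑ p ∈ Finset.univ.filter (fun p : Fin N × Fin N => p.1 < p.2), a p.1 p.2 := by
  have h1 : ∀ p : Fin N × Fin N, a p.1 p.2 = (if p.1 = p.2 then a p.1 p.2 else 0)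
      + ((if p.1 < p.2 then a p.1 p.2 else 0) + (if p.2 < p.1 then a p.1 p.2 else 0)) := by
    intro p
    rcases lt_trichotomy p.1 p.2 with h | h | h
    · simp [h, h.ne, h.not_gt]
    · simp [h]
    · simp [h, h.ne', h.not_gt]
  have h2 : ∑ p : Fin N × Fin N, (if p.2 < p.1 then a p.1 p.2 else 0)
      = ∑ p : Fin N × Fin N, (if p.1 < p.2 then a p.1 p.2 else 0) := by
    rw [← (Equiv.prodComm (Fin N) (Fin N)).sum_comp]
    exact Finset.sum_congr rfl fun p _ => by simp [ha p.2 p.1]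
  rw [← Fintype.sum_prod_type' (f := a), Finset.sum_congr rfl fun p _ => h1 p,
    Finset.sum_add_distrib, Finset.sum_add_distrib, h2, Finset.sum_filter, ← two_mul,
    Fintype.sum_prod_type]
  simp

/-- Second moment of a degenerate symmetric statistic of order two. -/
lemma integral_degenerate_sq_le {D : S → S → ℝ} (hD : BddMeas (Function.uncurry D))
    (hsymm : ∀ u v, D u v = D v u) (h0 : ∀ u, ∫ v, D u v ∂μ = 0) (hN : 1 ≤ N) :
    ∫ y, ((2 / (N : ℝ)) * ∑ p ∈ Finset.univ.filter (fun p : Fin N × Fin N => p.1 < p.2),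
        D (y p.1) (y p.2)) ^ 2 ∂(Measure.pi fun _ : Fin N => μ)
      ≤ 4 * ∫ u, ∫ v, D u v ^ 2 ∂μ ∂μ := by
  have hN' : (0 : ℝ) < N := by exact_mod_cast hN
  have hT : ∀ p : Fin N × Fin N, BddMeas (fun y : Fin N → S => D (y p.1) (y p.2)) := fun p =>
    hD.comp (u := fun y : Fin N → S => (y p.1, y p.2)) (by fun_prop)
  simp_rw [mul_pow]
  rw [integral_const_mul, integral_sum_sq_of_orthogonal _ hT]
  · have h2 : ∀ p ∈ Finset.univ.filter (fun p : Fin N × Fin N => p.1 < p.2),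
        ∫ y, D (y p.1) (y p.2) ^ 2 ∂(Measure.pi fun _ : Fin N => μ)
          = ∫ u, ∫ v, D u v ^ 2 ∂μ ∂μ := fun p hp =>
      integral_pi_eval_pair (G := fun u v => D u v ^ 2) hD.sq (Finset.mem_filter.1 hp).2.ne
    rw [Finset.sum_congr rfl h2, Finset.sum_const, nsmul_eq_mul, ← mul_assoc]
    refine mul_le_mul_of_nonneg_right ?_
      (integral_nonneg fun u => integral_nonneg fun v => sq_nonneg _)
    have hc : ((Finset.univ.filter (fun p : Fin N × Fin N => p.1 < p.2)).card : ℝ) ≤ N ^ 2 := by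
      have := Finset.card_filter_le (Finset.univ) (fun p : Fin N × Fin N => p.1 < p.2)
      rw [Finset.card_univ, Fintype.card_prod, Fintype.card_fin, ← sq] at this
      exact_mod_cast this
    calc (2 / (N : ℝ)) ^ 2 * _ ≤ (2 / (N : ℝ)) ^ 2 * N ^ 2 := by gcongr
      _ = 4 := by field_simp; norm_num
  · rintro ⟨j, k⟩ hp ⟨j', k'⟩ hp' hne
    simp only [Finset.mem_filter, Finset.mem_univ, true_and] at hp hp'
    -- Two distinct increasing pairs cannot share both entries, so the first has an index absent
    -- from the second; integrating out that coordinate kills the product by degeneracy.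
    have hcase : (k ≠ j' ∧ k ≠ k') ∨ (j ≠ j' ∧ j ≠ k') := by
      by_contra hcon
      simp only [ne_eq, Prod.mk.injEq] at hne
      omega
    rcases hcase with ⟨h1, h2⟩ | ⟨h1, h2⟩
    · refine integral_pi_eq_zero ((hT (j, k)).mul (hT (j', k'))) k fun y => ?_
      simp only [Function.update_of_ne hp.ne, Function.update_of_ne h1.symm,
        Function.update_of_ne h2.symm, Function.update_self]
      rw [integral_mul_const, h0, zero_mul]
    · refine integral_pi_eq_zero ((hT (j, k)).mul (hT (j', k'))) j fun y => ?_
      simp only [Function.update_of_ne hp.ne', Function.update_of_ne h1.symm,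
        Function.update_of_ne h2.symm, Function.update_self]
      simp_rw [fun u => hsymm u (y k)]
      rw [integral_mul_const, h0, zero_mul]

end Sample

/-! ### Hoeffding decomposition of quadratic statistics and of class sums. -/

section Quadratic

variable {S : Type*} [MeasurableSpace S] {N : ℕ} {μ : Measure S} [IsProbabilityMeasure μ]

/-- The second moment of the canonical (Hoeffding) kernel is at most that of the original one. -/
lemma integral_canonical_sq_le {H : S → S → ℝ} (hH : BddMeas (Function.uncurry H))
    (hsymm : ∀ u v, H u v = H v u) :
    ∫ u, ∫ v, (H u v - ∫ w, H u w ∂μ - ∫ w, H v w ∂μ + ∫ x, ∫ w, H x w ∂μ ∂μ) ^ 2 ∂μ ∂μ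
      ≤ ∫ u, ∫ v, H u v ^ 2 ∂μ ∂μ := by
  set H1 : S → ℝ := fun u => ∫ w, H u w ∂μ with hH1
  have bH1 : BddMeas H1 := hH.integral_right μ
  have bHu : ∀ u, BddMeas (H u) := fun u => hH.comp (u := fun v => (u, v)) (by fun_prop)
  have bHv : ∀ v, BddMeas (fun u => H u v) := fun v => hH.comp (u := fun u => (u, v)) (by fun_prop)
  have bK : BddMeas (Function.uncurry fun u v => H u v - H1 v) := hH.sub (bH1.comp measurable_snd)
  have bD : BddMeas (Function.uncurry fun u v => H u v - H1 u - H1 v + ∫ x, H1 x ∂μ) :=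
    ((hH.sub (bH1.comp measurable_fst)).sub (bH1.comp measurable_snd)).add (BddMeas.const _)
  -- The canonical kernel arises by centring H twice: first in u, giving H u v - H1 v, then in v.
  -- Each centring replaces a second moment by a variance, hence does not increase it.
  calc _ ≤ ∫ u, ∫ v, (H u v - H1 v) ^ 2 ∂μ ∂μ := by
        refine integral_mono (BddMeas.integrable (bD.sq.integral_right μ) μ)
          (BddMeas.integrable (bK.sq.integral_right μ) μ) fun u => ?_
        have hi : ∫ v, (H u v - H1 v) ∂μ = H1 u - ∫ x, H1 x ∂μ :=
          integral_sub ((bHu u).integrable μ) (bH1.integrable μ)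
        refine le_trans (le_of_eq ?_) (integral_sub_integral_sq_le (μ := μ) ((bHu u).sub bH1))
        refine integral_congr_ae (Eventually.of_forall fun v => ?_)
        simp only [hi]
        ring
    _ = ∫ v, ∫ u, (H u v - H1 v) ^ 2 ∂μ ∂μ :=
        integral_integral_swap (bK.sq.integrable _)
    _ ≤ ∫ v, ∫ u, H u v ^ 2 ∂μ ∂μ := by
        refine integral_mono
          (BddMeas.integrable (BddMeas.integral_right (bK.sq.comp measurable_swap) μ) μ)
          (BddMeas.integrable (BddMeas.integral_right (hH.sq.comp measurable_swap) μ) μ) fun v => ?_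
        have hi : ∫ u, H u v ∂μ = H1 v := by simp_rw [fun u => hsymm u v]; rfl
        simpa only [hi] using integral_sub_integral_sq_le (μ := μ) (bHv v)
    _ = _ := (integral_integral_swap (hH.sq.integrable _)).symm

/-- Concentration of a symmetric statistic of order two of an i.i.d. sample. -/
lemma integral_quadratic_sub_sq_le {H : S → S → ℝ} (hH : BddMeas (Function.uncurry H))
    (hsymm : ∀ u v, H u v = H v u) (hN : 1 ≤ N) :
    ∫ y, ((1 / (N : ℝ)) * ∑ j, ∑ k, H (y j) (y k)
        - (∫ u, H u u ∂μ + ((N : ℝ) - 1) * ∫ u, ∫ v, H u v ∂μ ∂μ)) ^ 2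
          ∂(Measure.pi fun _ : Fin N => μ)
      ≤ 6 / (N : ℝ) * (∫ u, H u u ^ 2 ∂μ + (∫ u, ∫ v, H u v ∂μ ∂μ) ^ 2)
        + 24 * N * ∫ u, (∫ v, H u v ∂μ) ^ 2 ∂μ + 8 * ∫ u, ∫ v, H u v ^ 2 ∂μ ∂μ := by
  have hN' : (0 : ℝ) < N := by exact_mod_cast hN
  have hcan := integral_canonical_sq_le (μ := μ) hH hsymm
  set H1 : S → ℝ := fun u => ∫ w, H u w ∂μ with hH1
  set H0 : ℝ := ∫ u, H1 u ∂μ with hH0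
  have bH1 : BddMeas H1 := hH.integral_right μ
  have bHu : ∀ u, BddMeas (H u) := fun u => hH.comp (u := fun v => (u, v)) (by fun_prop)
  have bd : BddMeas (fun u => H u u) := hH.comp (u := fun u => (u, u)) (by fun_prop)
  set D : S → S → ℝ := fun u v => H u v - H1 u - H1 v + H0 with hD
  have bD : BddMeas (Function.uncurry D) :=
    ((hH.sub (bH1.comp measurable_fst)).sub (bH1.comp measurable_snd)).add (BddMeas.const _)
  have Dsymm : ∀ u v, D u v = D v u := fun u v => by simp only [hD, hsymm u v]; ring
  have D0 : ∀ u, ∫ v, D u v ∂μ = 0 := fun u => by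
    have i1 : Integrable (fun v => H u v - H1 u) μ :=
      ((bHu u).sub (BddMeas.const _)).integrable μ
    have i2 : Integrable (fun v => H u v - H1 u - H1 v) μ :=
      (((bHu u).sub (BddMeas.const _)).sub bH1).integrable μ
    simp only [hD]
    rw [integral_add i2 (integrable_const _), integral_sub i1 (bH1.integrable μ),
      integral_sub ((bHu u).integrable μ) (integrable_const _)]
    simp [hH0, hH1]
  -- The linear part of the Hoeffding decomposition. The constant H0 cancels in the deviation from
  -- the mean; with it φ u = D u u + 2N H1 u, which is the form needed in `h3`.
  set φ : S → ℝ := fun u => H u u + (2 * N - 2) * H1 u + H0 with hφ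
  have bφ : BddMeas φ := (bd.add (bH1.const_mul _)).add (BddMeas.const _)
  have hφi : ∫ u, φ u ∂μ = ∫ u, H u u ∂μ + (2 * N - 1) * H0 := by
    simp only [hφ]
    rw [integral_add ((bd.add (bH1.const_mul _)).integrable μ) (integrable_const _),
      integral_add (bd.integrable μ) ((bH1.const_mul _).integrable μ), integral_const_mul]
    simp
    ring
  have hdec : ∀ y : Fin N → S, (1 / (N : ℝ)) * ∑ j, ∑ k, H (y j) (y k)
      - (∫ u, H u u ∂μ + ((N : ℝ) - 1) * H0)
      = ((1 / (N : ℝ)) * ∑ j, φ (y j) - ∫ u, φ u ∂μ)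
        + (2 / (N : ℝ)) * ∑ p ∈ Finset.univ.filter (fun p : Fin N × Fin N => p.1 < p.2),
          D (y p.1) (y p.2) := by
    intro y
    have h1 := sum_sum_eq_diag_add_two_mul (fun j k => D (y j) (y k)) fun i j => Dsymm _ _
    have h2 : ∑ j, ∑ k, D (y j) (y k)
        = ∑ j, ∑ k, H (y j) (y k) - 2 * N * ∑ j, H1 (y j) + N ^ 2 * H0 := by
      simp only [hD, Finset.sum_add_distrib, Finset.sum_sub_distrib, Finset.sum_const,
        Finset.card_univ, Fintype.card_fin, nsmul_eq_mul, ← Finset.mul_sum]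
      ring
    have h3 : ∑ j, D (y j) (y j) = ∑ j, φ (y j) - 2 * N * ∑ j, H1 (y j) := by
      rw [Finset.mul_sum, ← Finset.sum_sub_distrib]
      exact Finset.sum_congr rfl fun j _ => by simp only [hD, hφ]; ring
    rw [h2, h3] at h1
    rw [hφi]
    field_simp
    linarith
  have bm : BddMeas (fun y : Fin N → S => (1 / (N : ℝ)) * ∑ j, φ (y j) - ∫ u, φ u ∂μ) :=
    ((BddMeas.sum fun j => bφ.comp (measurable_pi_apply j)).const_mul _).sub (BddMeas.const _)
  have bq : BddMeas (fun y : Fin N → S =>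
      (2 / (N : ℝ)) * ∑ p ∈ Finset.univ.filter (fun p : Fin N × Fin N => p.1 < p.2),
        D (y p.1) (y p.2)) :=
    (BddMeas.sum fun p : Fin N × Fin N => bD.comp (u := fun y : Fin N → S => (y p.1, y p.2))
      (by fun_prop)).const_mul _
  simp_rw [hdec]
  have hmean := integral_mean_sub_sq_le (μ := μ) bφ hN
  have hdeg := integral_degenerate_sq_le bD Dsymm D0 hN
  have hφ2 : ∫ u, φ u ^ 2 ∂μ
      ≤ 3 * (∫ u, H u u ^ 2 ∂μ + 4 * N ^ 2 * ∫ u, H1 u ^ 2 ∂μ + H0 ^ 2) := by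
    have i2 : Integrable (fun u => H u u ^ 2 + 4 * (N : ℝ) ^ 2 * H1 u ^ 2) μ :=
      (bd.sq.add (bH1.sq.const_mul _)).integrable μ
    have : ∫ u, 3 * (H u u ^ 2 + 4 * (N : ℝ) ^ 2 * H1 u ^ 2 + H0 ^ 2) ∂μ
        = 3 * (∫ u, H u u ^ 2 ∂μ + 4 * N ^ 2 * ∫ u, H1 u ^ 2 ∂μ + H0 ^ 2) := by
      rw [integral_const_mul, integral_add i2 (integrable_const _),
        integral_add (bd.sq.integrable μ) ((bH1.sq.const_mul _).integrable μ), integral_const_mul]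
      simp
    rw [← this]
    refine integral_mono (bφ.sq.integrable μ)
      (((bd.sq.add (bH1.sq.const_mul _)).add (BddMeas.const _)).const_mul _ |>.integrable μ)
      fun u => ?_
    have hN1 : (1 : ℝ) ≤ N := by exact_mod_cast hN
    have hb : ((2 * (N : ℝ) - 2) * H1 u) ^ 2 ≤ 4 * (N : ℝ) ^ 2 * H1 u ^ 2 := by
      rw [mul_pow]
      exact mul_le_mul_of_nonneg_right (by nlinarith) (sq_nonneg _)
    simp only [hφ]
    nlinarith [sq_nonneg (H u u - (2 * (N : ℝ) - 2) * H1 u), sq_nonneg (H u u - H0),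
      sq_nonneg ((2 * (N : ℝ) - 2) * H1 u - H0)]
  -- Separating the linear from the degenerate part costs a factor 2, and the three terms of φ a
  -- factor 3; hence 6 = 2·3, 24 = 2·3·4 and 8 = 2·4.
  calc _ ≤ ∫ y, (2 * ((1 / (N : ℝ)) * ∑ j, φ (y j) - ∫ u, φ u ∂μ) ^ 2
        + 2 * ((2 / (N : ℝ)) * ∑ p ∈ Finset.univ.filter (fun p : Fin N × Fin N => p.1 < p.2),
          D (y p.1) (y p.2)) ^ 2) ∂(Measure.pi fun _ : Fin N => μ) := by
        refine integral_mono ((bm.add bq).sq.integrable _)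
          (((bm.sq.const_mul 2).add (bq.sq.const_mul 2)).integrable _) fun y => ?_
        exact add_sq_le.trans (by rw [mul_add])
    _ ≤ 2 * ((1 / (N : ℝ)) * (3 * (∫ u, H u u ^ 2 ∂μ + 4 * N ^ 2 * ∫ u, H1 u ^ 2 ∂μ + H0 ^ 2)))
        + 2 * (4 * ∫ u, ∫ v, H u v ^ 2 ∂μ ∂μ) := by
        rw [integral_add ((bm.sq.const_mul 2).integrable _) ((bq.sq.const_mul 2).integrable _),
          integral_const_mul, integral_const_mul]
        gcongr
        · exact hmean.trans (by gcongr)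
        · exact hdeg.trans (by gcongr)
    _ = _ := by field_simp; ring

/-- The sum over the classes of a partition of the squared class sums of an i.i.d. sample. -/
lemma integral_classSum_sub_sq_le {κ : Type*} [Fintype κ] [DecidableEq κ] [MeasurableSpace κ]
    [MeasurableSingletonClass κ] {e : S → κ} (he : Measurable e) {f : S → ℝ} (hf : Measurable f)
    {C : ℝ} (hC : ∀ u, |f u| ≤ C) (hN : 1 ≤ N) {Q : ℝ}
    (hQ : Q = ∑ i, (∫ u, (if e u = i then (1 : ℝ) else 0) ∂μ) ^ 2) :
    ∫ y, ((1 / (N : ℝ)) * ∑ i, (∑ j ∈ Finset.univ.filter (fun j => e (y j) = i), f (y j)) ^ 2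
        - (∫ u, f u ^ 2 ∂μ + ((N : ℝ) - 1) * ∑ i, (∫ u, (if e u = i then f u else 0) ∂μ) ^ 2)) ^ 2
          ∂(Measure.pi fun _ : Fin N => μ)
      ≤ C ^ 4 * (12 / (N : ℝ) + 24 * N * (√Q * Q) + 8 * Q) := by
  have hN' : (0 : ℝ) < N := by exact_mod_cast hN
  have bf : BddMeas f := ⟨hf, C, hC⟩
  set m : κ → ℝ := fun i => ∫ u, (if e u = i then f u else 0) ∂μ with hm
  set q : κ → ℝ := fun i => ∫ u, (if e u = i then (1 : ℝ) else 0) ∂μ with hq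
  have bF : ∀ (f : S → ℝ), BddMeas f → ∀ i, BddMeas (fun u => if e u = i then f u else 0) :=
    fun f bf i => bf.ite (s := {u | e u = i}) (he (measurableSet_singleton i))
  have b1 := bF _ (BddMeas.const 1)
  have hq0 : ∀ i, 0 ≤ q i := fun i => integral_nonneg fun u => by
    simp only [Pi.zero_apply]; split_ifs <;> norm_num
  have hQ0 : 0 ≤ Q := hQ ▸ Finset.sum_nonneg fun i _ => sq_nonneg _
  -- The largest class mass is at most the ℓ² norm of the masses. This reduces the third-order sum ∑
  -- q i ^ 3 met below to Q alone.
  have hqQ : ∀ i, q i ≤ √Q := fun i => by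
    refine Real.le_sqrt_of_sq_le ?_
    rw [hQ]
    exact Finset.single_le_sum (f := fun i => q i ^ 2) (fun i _ => sq_nonneg _) (Finset.mem_univ i)
  have hmq : ∀ i, m i ^ 2 ≤ C ^ 2 * q i ^ 2 := fun i => by
    rw [← mul_pow, sq_le_sq]
    refine le_trans ?_ (le_abs_self _)
    rw [abs_le, hq, ← integral_const_mul, hm, ← integral_neg]
    constructor <;> refine integral_mono ?_ ?_ fun u => ?_
    · exact ((b1 i).const_mul C).integrable μ |>.neg
    · exact (bF f bf i).integrable μ
    · have := abs_le.1 (hC u); dsimp only; split_ifs <;> simp; linarith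
    · exact (bF f bf i).integrable μ
    · exact ((b1 i).const_mul C).integrable μ
    · have := abs_le.1 (hC u); dsimp only; split_ifs <;> simp; linarith
  -- The kernel f u * f v restricted to pairs in the same class, written as a sum of products so
  -- that its partial integrals factor.
  set H : S → S → ℝ := fun u v => ∑ i, (if e u = i then f u else 0) * (if e v = i then f v else 0)
    with hH
  have Hif : ∀ u v, H u v = if e u = e v then f u * f v else 0 := fun u v => by simp [hH]
  have bH : BddMeas (Function.uncurry H) := BddMeas.sum fun i =>
    ((bF f bf i).comp measurable_fst).mul ((bF f bf i).comp measurable_snd)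
  have hs : ∀ u v, H u v = H v u := fun u v => by simp only [hH, mul_comm]
  have hdiag : ∀ u, H u u = f u ^ 2 := fun u => by rw [Hif]; simp [sq]
  have H1 : ∀ u, ∫ v, H u v ∂μ = ∑ i, (if e u = i then f u else 0) * m i := fun u => by
    simp only [hH, hm]
    rw [integral_finsetSum _ fun i _ => ((bF f bf i).const_mul _).integrable μ]
    simp_rw [integral_const_mul]
  have H0 : ∫ u, ∫ v, H u v ∂μ ∂μ = ∑ i, m i ^ 2 := by
    simp_rw [H1]
    rw [integral_finsetSum _ fun i _ => ((bF f bf i).mul (BddMeas.const _)).integrable μ]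
    simp_rw [integral_mul_const, sq]
    rfl
  have hC2 : ∀ u, f u ^ 2 ≤ C ^ 2 := fun u => sq_le_sq.2 ((hC u).trans (le_abs_self C))
  have e4 : C ^ 4 = C ^ 2 * C ^ 2 := by ring
  have hd2 : ∫ u, H u u ^ 2 ∂μ ≤ C ^ 4 := by
    have : ∫ _, C ^ 4 ∂μ = C ^ 4 := by simp
    rw [← this]
    refine integral_mono ?_ (integrable_const _) fun u => ?_
    · simp_rw [hdiag]; exact bf.sq.sq.integrable μ
    · dsimp only
      rw [hdiag, e4, sq (f u ^ 2)]
      exact mul_le_mul (hC2 u) (hC2 u) (sq_nonneg _) (sq_nonneg _)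
  have hHsq : ∀ u v, H u v ^ 2 ≤ C ^ 4 *
      ∑ i, (if e u = i then (1 : ℝ) else 0) * (if e v = i then (1 : ℝ) else 0) := fun u v => by
    rw [Hif]
    simp only [mul_ite, mul_one, mul_zero, Finset.sum_ite_eq, Finset.mem_univ, if_true]
    split_ifs with h
    · rw [e4, mul_pow]
      exact mul_le_mul (hC2 u) (hC2 v) (sq_nonneg _) (sq_nonneg _)
    · simp
  have b11 : BddMeas (Function.uncurry fun u v => C ^ 4 *
      ∑ i, (if e u = i then (1 : ℝ) else 0) * (if e v = i then (1 : ℝ) else 0)) :=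
    (BddMeas.sum fun i => ((b1 i).comp measurable_fst).mul
      ((b1 i).comp measurable_snd)).const_mul (C ^ 4)
  have hHH : ∫ u, ∫ v, H u v ^ 2 ∂μ ∂μ ≤ C ^ 4 * Q := by
    have h1 : ∫ u, ∫ v, (C ^ 4 *
        ∑ i, (if e u = i then (1 : ℝ) else 0) * (if e v = i then (1 : ℝ) else 0)) ∂μ ∂μ
          = C ^ 4 * Q := by
      simp_rw [integral_const_mul]
      have h2 : ∀ u, ∫ v, (∑ i, (if e u = i then (1 : ℝ) else 0) * (if e v = i then (1 : ℝ) else 0))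
          ∂μ = ∑ i, (if e u = i then (1 : ℝ) else 0) * q i := fun u => by
        rw [integral_finsetSum _ fun i _ => ((b1 i).const_mul _).integrable μ]
        simp_rw [integral_const_mul]; rfl
      simp_rw [h2]
      rw [integral_finsetSum _ fun i _ => ((b1 i).mul (BddMeas.const _)).integrable μ, hQ]
      simp_rw [integral_mul_const, sq]
      rfl
    rw [← h1]
    refine integral_mono (BddMeas.integrable (bH.sq.integral_right μ) μ)
      (BddMeas.integrable (b11.integral_right μ) μ) fun u => ?_
    exact integral_mono (BddMeas.integrable (bH.sq.comp (u := fun v => (u, v)) (by fun_prop)) μ)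
      (BddMeas.integrable (b11.comp (u := fun v => (u, v)) (by fun_prop)) μ) (hHsq u)
  have hH0 : (∫ u, ∫ v, H u v ∂μ ∂μ) ^ 2 ≤ C ^ 4 := by
    have hb : ∀ u v, ‖H u v‖ ≤ C ^ 2 := fun u v => by
      rw [Hif]
      split_ifs
      · rw [Real.norm_eq_abs, abs_mul, sq]
        exact mul_le_mul (hC u) (hC v) (abs_nonneg _) ((abs_nonneg _).trans (hC u))
      · simpa using sq_nonneg C
    have h2 : ‖∫ u, ∫ v, H u v ∂μ ∂μ‖ ≤ C ^ 2 := by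
      have h1 : ∀ u, ‖∫ v, H u v ∂μ‖ ≤ C ^ 2 := fun u => by
        simpa using norm_integral_le_of_norm_le_const (μ := μ) (Eventually.of_forall (hb u))
      simpa using norm_integral_le_of_norm_le_const (μ := μ) (Eventually.of_forall h1)
    calc _ ≤ (C ^ 2) ^ 2 := sq_le_sq.2 (h2.trans (le_abs_self _))
      _ = _ := by ring
  -- The inner integral is f u times the integral of f over the class of u, so its square is at most
  -- C⁴ times the squared mass of that class; averaging over u yields ∑ q i ^ 3. When Q is of order
  -- 1/N, N√Q·Q is only of order N^(-1/2), so the factor N in front is harmless.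
  have hH1 : ∫ u, (∫ v, H u v ∂μ) ^ 2 ∂μ ≤ C ^ 4 * (√Q * Q) := by
    have hb : ∀ u, (∫ v, H u v ∂μ) ^ 2
        ≤ C ^ 4 * ∑ i, (if e u = i then (1 : ℝ) else 0) * q i ^ 2 := fun u => by
      rw [H1]
      simp only [ite_mul, zero_mul, one_mul, Finset.sum_ite_eq, Finset.mem_univ, if_true]
      rw [mul_pow, e4, mul_assoc]
      exact mul_le_mul (hC2 u) (hmq _) (sq_nonneg _) (sq_nonneg _)
    have h1 : ∫ u, (C ^ 4 * ∑ i, (if e u = i then (1 : ℝ) else 0) * q i ^ 2) ∂μ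
        = C ^ 4 * ∑ i, q i * q i ^ 2 := by
      rw [integral_const_mul,
        integral_finsetSum _ fun i _ => ((b1 i).mul (BddMeas.const _)).integrable μ]
      simp_rw [integral_mul_const]
      rfl
    calc _ ≤ C ^ 4 * ∑ i, q i * q i ^ 2 := by
          rw [← h1]
          exact integral_mono (BddMeas.integrable (BddMeas.sq (bH.integral_right μ)) μ)
            (((BddMeas.sum fun i => (b1 i).mul (BddMeas.const _)).const_mul _).integrable μ) hb
      _ ≤ C ^ 4 * (√Q * Q) := by
          refine mul_le_mul_of_nonneg_left ?_ (by positivity)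
          rw [hQ, Finset.mul_sum, ← hQ]
          exact Finset.sum_le_sum fun i _ => mul_le_mul_of_nonneg_right (hqQ i) (sq_nonneg _)
  have hmain := integral_quadratic_sub_sq_le (μ := μ) bH hs hN
  have hstat : ∀ y : Fin N → S,
      ∑ i, (∑ j ∈ Finset.univ.filter (fun j => e (y j) = i), f (y j)) ^ 2
        = ∑ j, ∑ k, H (y j) (y k) := fun y => by
    simp_rw [Finset.sum_filter, sq, Finset.sum_mul_sum, hH]
    rw [Finset.sum_comm]
    exact Finset.sum_congr rfl fun j _ => Finset.sum_comm
  have hd : ∫ u, H u u ∂μ = ∫ u, f u ^ 2 ∂μ := by simp_rw [hdiag]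
  simp_rw [hstat]
  rw [H0, hd] at hmain
  refine hmain.trans ?_
  rw [H0] at hH0
  calc _ ≤ 6 / (N : ℝ) * (C ^ 4 + C ^ 4) + 24 * N * (C ^ 4 * (√Q * Q)) + 8 * (C ^ 4 * Q) := by
        gcongr
    _ = _ := by ring

end Quadratic

/-! ### The conditional law of one step of the particle filter -/

lemma sum_weight_pos {X : Type*} {N : ℕ} {w : X → ℝ} (hw : ∀ x, 0 < w x) (hN : 1 ≤ N)
    (x : Fin N → X) : 0 < ∑ l, w (x l) :=
  Finset.sum_pos (fun _ _ => hw _) ⟨⟨0, hN⟩, Finset.mem_univ _⟩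

section MutationLaw

variable {X : Type*} [MeasurableSpace X] {N : ℕ}

/-- The conditional law of a pair (ancestor index, particle) given the parent particles `x`. -/
noncomputable def mutationLaw (M : Kernel X X) (w : X → ℝ) (x : Fin N → X) :
    Measure (Fin N × X) :=
  ∑ k, ENNReal.ofReal (w (x k) / ∑ l, w (x l)) • (Measure.dirac k).prod (M (x k))

variable {M : Kernel X X} [IsMarkovKernel M] {w : X → ℝ}

lemma mutationLaw_apply (x : Fin N → X) {s : Set (Fin N × X)} (hs : MeasurableSet s) :
    mutationLaw M w x s
      = ∑ k, ENNReal.ofReal (w (x k) / ∑ l, w (x l)) * M (x k) (Prod.mk k ⁻¹' s) := by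
  simp only [mutationLaw, Measure.coe_finsetSum, Finset.sum_apply, Measure.smul_apply, smul_eq_mul]
  refine Finset.sum_congr rfl fun k _ => ?_
  rw [Measure.prod_apply hs, lintegral_dirac]

instance (x : Fin N → X) : IsFiniteMeasure (mutationLaw M w x) := by
  refine ⟨?_⟩
  rw [mutationLaw_apply x MeasurableSet.univ]
  exact ENNReal.sum_lt_top.2 fun k _ => ENNReal.mul_lt_top ENNReal.ofReal_lt_top
    (measure_lt_top _ _)

lemma isProbabilityMeasure_mutationLaw (hw : ∀ x, 0 < w x) (hN : 1 ≤ N) (x : Fin N → X) :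
    IsProbabilityMeasure (mutationLaw M w x) := by
  have h0 := sum_weight_pos hw hN x
  refine ⟨?_⟩
  rw [mutationLaw_apply x MeasurableSet.univ]
  simp only [Set.preimage_univ, measure_univ, mul_one]
  rw [← ENNReal.ofReal_sum_of_nonneg fun k _ => div_nonneg (hw _).le h0.le, ← Finset.sum_div,
    div_self h0.ne', ENNReal.ofReal_one]

lemma integral_mutationLaw (hw : ∀ x, 0 < w x) (x : Fin N → X)
    {F : Fin N × X → ℝ} (hF : BddMeas F) :
    ∫ p, F p ∂(mutationLaw M w x) = ∑ k, w (x k) / (∑ l, w (x l)) * ∫ u, F (k, u) ∂(M (x k)) := by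
  rw [mutationLaw, integral_finsetSum_measure fun k _ =>
    (hF.integrable ((Measure.dirac k).prod (M (x k)))).smul_measure ENNReal.ofReal_ne_top]
  refine Finset.sum_congr rfl fun k _ => ?_
  rw [integral_smul_measure, integral_prod _ (hF.integrable _), integral_dirac,
    ENNReal.toReal_ofReal (div_nonneg (hw _).le (Finset.sum_nonneg fun l _ => (hw _).le)),
    smul_eq_mul]

lemma measurable_mutationLaw_apply (hw : Measurable w) {s : Set (Fin N × X)}
    (hs : MeasurableSet s) : Measurable (fun x : Fin N → X => mutationLaw M w x s) := by
  simp_rw [fun x : Fin N → X => mutationLaw_apply (M := M) (w := w) x hs]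
  refine Finset.measurable_sum _ fun k _ => Measurable.mul ?_ ?_
  · have h1 : Measurable (fun x : Fin N → X => w (x k)) := hw.comp (measurable_pi_apply k)
    have h2 : Measurable (fun x : Fin N → X => ∑ l, w (x l)) :=
      Finset.measurable_sum _ fun l _ => hw.comp (measurable_pi_apply l)
    exact (h1.div h2).ennreal_ofReal
  · exact (M.measurable_coe (measurable_prodMk_left hs)).comp (measurable_pi_apply k)

/-- The conditional law of all the pairs (ancestor index, particle), as a kernel on the parent
particles. -/
noncomputable def generationKernel (M : Kernel X X) [IsMarkovKernel M] {w : X → ℝ}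
    (hm : Measurable w) (hw : ∀ x, 0 < w x) (hN : 1 ≤ N) :
    Kernel (Fin N → X) (Fin N → Fin N × X) where
  toFun x := Measure.pi fun _ => mutationLaw M w x
  measurable' := by
    -- For probability measures, measurability in x need only be checked on the π-system of boxes,
    -- where the mass is a finite product.
    have := fun x => isProbabilityMeasure_mutationLaw (M := M) hw hN x
    refine Measurable.measure_of_isPiSystem_of_isProbabilityMeasure generateFrom_pi.symm
      isPiSystem_pi ?_
    rintro _ ⟨t, ht, rfl⟩
    simp only [Measure.pi_pi]
    exact Finset.measurable_prod _ fun i _ =>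
      measurable_mutationLaw_apply hm (ht i (Set.mem_univ i))

lemma generationKernel_apply (hm : Measurable w) (hw : ∀ x, 0 < w x) (hN : 1 ≤ N)
    (x : Fin N → X) :
    generationKernel M hm hw hN x = Measure.pi fun _ => mutationLaw M w x := rfl

instance (hm : Measurable w) (hw : ∀ x, 0 < w x) (hN : 1 ≤ N) :
    IsMarkovKernel (generationKernel M hm hw hN) := by
  refine ⟨fun x => ?_⟩
  have := isProbabilityMeasure_mutationLaw (M := M) hw hN x
  rw [generationKernel_apply]
  infer_instance

end MutationLaw

/-! ### Genealogies, the joint law of successive generations, conditional Chebyshev. -/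

section Step

variable {X Z Ω : Type*} [MeasurableSpace X] {N : ℕ}

lemma history_mono (ξ : ℕ → Ω → Fin N → X) (I : ℕ → Ω → Fin N → Fin N) {m m' : ℕ} (h : m ≤ m') :
    history ξ I m ≤ history ξ I m' :=
  sup_le_sup (biSup_mono fun _ hj => le_trans (Set.mem_Iic.1 hj) h)
    (biSup_mono fun _ hj => ⟨hj.1, hj.2.trans h⟩)

lemma measurable_history_particle (ξ : ℕ → Ω → Fin N → X) (I : ℕ → Ω → Fin N → Fin N) (m : ℕ) :
    Measurable[history ξ I m] (ξ m) := by
  refine Measurable.of_comap_le (le_trans ?_ le_sup_left)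
  exact le_biSup (fun j => MeasurableSpace.comap (ξ j) inferInstance) (Set.mem_Iic.2 le_rfl)

lemma measurable_history_index (ξ : ℕ → Ω → Fin N → X) (I : ℕ → Ω → Fin N → Fin N) {m : ℕ}
    (hm : 1 ≤ m) : Measurable[history ξ I m] (I m) := by
  refine Measurable.of_comap_le (le_trans ?_ le_sup_right)
  exact le_biSup (fun j => MeasurableSpace.comap (I j) inferInstance)
    (Set.mem_Icc.2 ⟨hm, le_rfl⟩)

lemma enoch_self (J : ℕ → Fin N → Fin N) (m : ℕ) (i : Fin N) : enoch J m m i = i := by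
  cases m <;> simp [enoch]

lemma enoch_succ (J : ℕ → Fin N → Fin N) {l m : ℕ} (h : l ≤ m) (i : Fin N) :
    enoch J l (m + 1) i = enoch J l m (J (m + 1) i) := by
  rw [enoch, if_neg (by omega)]

lemma measurable_history_enoch (ξ : ℕ → Ω → Fin N → X) (I : ℕ → Ω → Fin N → Fin N) (l m : ℕ) :
    Measurable[history ξ I m] (fun ω => enoch (fun k => I k ω) l m) := by
  induction m with
  | zero => exact @measurable_const _ _ _ (history ξ I 0) (fun i => i)
  | succ m ih =>
    by_cases h : m + 1 ≤ l
    · have : (fun ω => enoch (fun k => I k ω) l (m + 1)) = fun _ i => i := by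
        funext ω i; rw [enoch, if_pos h]
      rw [this]
      exact @measurable_const _ _ _ (history ξ I (m + 1)) (fun i => i)
    · have h1 : Measurable[history ξ I (m + 1)] (fun ω => enoch (fun k => I k ω) l m) :=
        ih.mono (history_mono ξ I m.le_succ) le_rfl
      have h2 := measurable_history_index ξ I (m := m + 1) (by omega)
      have h3 : Measurable (fun p : (Fin N → Fin N) × (Fin N → Fin N) => p.1 ∘ p.2) :=
        measurable_of_countable _
      have h4 := h3.comp (Measurable.prodMk h1 h2)
      convert h4 using 1
      funext ω i
      exact enoch_succ _ (by omega) i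

/-- The particles at time `m` together with their ancestor indices at time `l`. -/
def genealogy (ξ : ℕ → Ω → Fin N → X) (I : ℕ → Ω → Fin N → Fin N) (l m : ℕ) (ω : Ω) :
    (Fin N → X) × (Fin N → Fin N) :=
  (ξ m ω, enoch (fun k => I k ω) l m)

/-- The ancestor indices and the particles of generation `m`. -/
def generation (ξ : ℕ → Ω → Fin N → X) (I : ℕ → Ω → Fin N → Fin N) (m : ℕ) (ω : Ω) :
    Fin N → Fin N × X :=
  fun i => (I m ω i, ξ m ω i)

lemma measurable_history_genealogy (ξ : ℕ → Ω → Fin N → X) (I : ℕ → Ω → Fin N → Fin N) (l m : ℕ) :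
    Measurable[history ξ I m] (genealogy ξ I l m) :=
  Measurable.prodMk (measurable_history_particle ξ I m) (measurable_history_enoch ξ I l m)

namespace IsParticleFilter

variable [MeasurableSpace Ω] {P : Measure Ω} {χ : Measure X} {M : Kernel X X}
  {g : Z → X → ℝ} {z : ℕ → Z} {T : ℕ} {ξ : ℕ → Ω → Fin N → X} {I : ℕ → Ω → Fin N → Fin N}

lemma history_le (hF : IsParticleFilter P χ M g z T ξ I) {m : ℕ} (hm : m ≤ T) :
    history ξ I m ≤ (inferInstance : MeasurableSpace Ω) :=
  sup_le (iSup₂_le fun j hj => (hF.measurable_particle j (le_trans hj hm)).comap_le)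
    (iSup₂_le fun j hj => (hF.measurable_index j hj.1 (hj.2.trans hm)).comap_le)

lemma measurable_genealogy (hF : IsParticleFilter P χ M g z T ξ I) (l : ℕ) {m : ℕ} (hm : m ≤ T) :
    Measurable (genealogy ξ I l m) :=
  (measurable_history_genealogy ξ I l m).mono (hF.history_le hm) le_rfl

lemma measurable_generation (hF : IsParticleFilter P χ M g z T ξ I) {m : ℕ} (h1 : 1 ≤ m)
    (hm : m ≤ T) : Measurable (generation ξ I m) :=
  measurable_pi_lambda _ fun i =>
    ((measurable_pi_apply i).comp (hF.measurable_index m h1 hm)).prodMk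
      ((measurable_pi_apply i).comp (hF.measurable_particle m hm))

variable [IsMarkovKernel M]

/-- Split the event by the value k of the whole index vector. Each piece is an instance of
`transition`, and summing over k turns the sum of products into the product of the sums that define
`mutationLaw`. -/
lemma measure_generation_box (hF : IsParticleFilter P χ M g z T ξ I) {m : ℕ} (hm : m < T)
    (hg : Measurable (g (z m))) {A : Set Ω} (hA : MeasurableSet[history ξ I m] A)
    {t : Fin N → Set (Fin N × X)} (ht : ∀ i, MeasurableSet (t i)) :
    P (A ∩ generation ξ I (m + 1) ⁻¹' (Set.univ.pi t))
      = ∫⁻ ω in A, ∏ i, mutationLaw M (g (z m)) (ξ m ω) (t i) ∂P := by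
  have hI := hF.measurable_index (m + 1) (by omega) hm
  have hξ := hF.measurable_particle m hm.le
  have h1 := sum_measure_preimage_singleton (μ := P.restrict
    (A ∩ generation ξ I (m + 1) ⁻¹' (Set.univ.pi t))) Finset.univ
    (fun k (_ : k ∈ (Finset.univ : Finset (Fin N → Fin N))) => hI (measurableSet_singleton k))
  rw [Finset.coe_univ, Set.preimage_univ, Measure.restrict_apply_univ] at h1
  rw [← h1]
  have h2 : ∀ k : Fin N → Fin N,
      P.restrict (A ∩ generation ξ I (m + 1) ⁻¹' (Set.univ.pi t)) (I (m + 1) ⁻¹' {k})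
        = ∫⁻ ω in A, ∏ i, (ENNReal.ofReal (g (z m) (ξ m ω (k i)) / ∑ l, g (z m) (ξ m ω l))
            * M (ξ m ω (k i)) (Prod.mk (k i) ⁻¹' t i)) ∂P := fun k => by
    rw [Measure.restrict_apply (hI (measurableSet_singleton k)), ← hF.transition m hm A hA k
      (fun i => Prod.mk (k i) ⁻¹' t i) fun i => measurable_prodMk_left (ht i)]
    congr 1
    ext ω
    simp only [Set.mem_inter_iff, Set.mem_preimage, Set.mem_singleton_iff, Set.mem_pi, generation,
      Set.mem_univ, forall_true_left, Set.mem_ofPred_eq]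
    constructor
    · rintro ⟨h, hA, hB⟩
      exact ⟨hA, fun i => ⟨congrFun h i, by rw [← congrFun h i]; exact hB i⟩⟩
    · rintro ⟨hA, hB⟩
      exact ⟨funext fun i => (hB i).1, hA, fun i => by rw [(hB i).1]; exact (hB i).2⟩
  rw [Finset.sum_congr rfl fun k _ => h2 k, ← lintegral_finsetSum]
  · refine lintegral_congr fun ω => ?_
    simp_rw [fun i => mutationLaw_apply (M := M) (w := g (z m)) (ξ m ω) (ht i)]
    rw [Finset.prod_univ_sum]
    simp
  · intro k _
    refine Finset.measurable_prod _ fun i _ => Measurable.mul ?_ ?_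
    · have h3 : ∀ l, Measurable (fun ω => g (z m) (ξ m ω l)) := fun l =>
        hg.comp ((measurable_pi_apply l).comp hξ)
      exact ((h3 (k i)).div (Finset.measurable_sum _ fun l _ => h3 l)).ennreal_ofReal
    · exact (M.measurable_coe (measurable_prodMk_left (ht i))).comp
        ((measurable_pi_apply (k i)).comp hξ)

variable [IsProbabilityMeasure P]

/-- Events of the genealogy at time m belong to the history, so `measure_generation_box` applies to
them. On each such event two finite measures of equal mass agree on boxes, hence everywhere. -/
lemma map_genealogy_generation (hF : IsParticleFilter P χ M g z T ξ I) {m : ℕ} (hm : m < T)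
    (l : ℕ) (hg : Measurable (g (z m))) (hpos : ∀ x, 0 < g (z m) x) (hN : 1 ≤ N) :
    P.map (fun ω => (genealogy ξ I l m ω, generation ξ I (m + 1) ω))
      = (P.map (genealogy ξ I l m)) ⊗ₘ
        ((generationKernel M hg hpos hN).comap Prod.fst measurable_fst) := by
  have hθ := hF.measurable_genealogy l hm.le
  have hY := hF.measurable_generation (m := m + 1) (by omega) hm
  have hprob : IsProbabilityMeasure (P.map (genealogy ξ I l m)) :=
    Measure.isProbabilityMeasure_map hθ.aemeasurable
  have hprob2 : IsProbabilityMeasure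
      (P.map (fun ω => (genealogy ξ I l m ω, generation ξ I (m + 1) ω))) :=
    Measure.isProbabilityMeasure_map (hθ.prodMk hY).aemeasurable
  refine Measure.ext_prod fun {B D} hB hD => ?_
  set K := (generationKernel M hg hpos hN).comap
    (Prod.fst : (Fin N → X) × (Fin N → Fin N) → _) measurable_fst with hK
  rw [Measure.map_apply (hθ.prodMk hY) (hB.prod hD), Measure.compProd_apply_prod hB hD,
    setLIntegral_map hB (K.measurable_coe hD) hθ]
  have hAB := measurable_history_genealogy ξ I l m hB
  have hKm : Measurable (fun ω => K (genealogy ξ I l m ω)) := K.measurable.comp hθ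
  have heq : (P.restrict (genealogy ξ I l m ⁻¹' B)).map (generation ξ I (m + 1))
      = (P.restrict (genealogy ξ I l m ⁻¹' B)).bind (fun ω => K (genealogy ξ I l m ω)) := by
    refine ext_of_generate_finite _ generateFrom_pi.symm isPiSystem_pi ?_ ?_
    · rintro _ ⟨t, ht, rfl⟩
      have ht' : ∀ i, MeasurableSet (t i) := fun i => ht i (Set.mem_univ i)
      rw [Measure.map_apply hY (MeasurableSet.univ_pi ht'),
        Measure.bind_apply (MeasurableSet.univ_pi ht') hKm.aemeasurable,
        Measure.restrict_apply (hY (MeasurableSet.univ_pi ht')), Set.inter_comm,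
        hF.measure_generation_box hm hg hAB ht']
      refine lintegral_congr fun ω => ?_
      simp [hK, generationKernel_apply, Measure.pi_pi, genealogy]
    · rw [Measure.map_apply hY MeasurableSet.univ,
        Measure.bind_apply MeasurableSet.univ hKm.aemeasurable]
      simp
  have h3 := congrArg (fun ν => ν D) heq
  beta_reduce at h3
  rw [Measure.map_apply hY hD, Measure.restrict_apply (hY hD),
    Measure.bind_apply hD hKm.aemeasurable] at h3
  rw [← h3, Set.inter_comm]
  rfl

/-- Conditional Chebyshev inequality. -/
lemma measure_ge_le (hF : IsParticleFilter P χ M g z T ξ I) {m : ℕ} (hm : m < T)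
    (l : ℕ) (hg : Measurable (g (z m))) (hpos : ∀ x, 0 < g (z m) x) (hN : 1 ≤ N)
    {s : (Fin N → X) × (Fin N → Fin N) → (Fin N → Fin N × X) → ℝ}
    (hs : Measurable (Function.uncurry s)) (hb : ∀ θ, BddMeas (s θ))
    {v : (Fin N → X) × (Fin N → Fin N) → ℝ}
    (hv : ∀ θ, ∫ y, s θ y ^ 2 ∂(Measure.pi fun _ : Fin N => mutationLaw M (g (z m)) θ.1) ≤ v θ)
    {ε δ : ℝ} (hε : 0 < ε) :
    P {ω | ε ≤ |s (genealogy ξ I l m ω) (generation ξ I (m + 1) ω)|}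
      ≤ P {ω | δ ≤ v (genealogy ξ I l m ω)} + ENNReal.ofReal (δ / ε ^ 2) := by
  have hθ := hF.measurable_genealogy l hm.le
  have hY := hF.measurable_generation (m := m + 1) (by omega) hm
  set D : Set (((Fin N → X) × (Fin N → Fin N)) × (Fin N → Fin N × X)) :=
    {p | ε ≤ |Function.uncurry s p|} with hD
  have hDm : MeasurableSet D := measurableSet_le measurable_const hs.abs
  have hprob : IsProbabilityMeasure (P.map (genealogy ξ I l m)) :=
    Measure.isProbabilityMeasure_map hθ.aemeasurable
  set K := (generationKernel M hg hpos hN).comap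
    (Prod.fst : (Fin N → X) × (Fin N → Fin N) → _) measurable_fst with hK
  have h1 : P {ω | ε ≤ |s (genealogy ξ I l m ω) (generation ξ I (m + 1) ω)|}
      = ∫⁻ ω, K (genealogy ξ I l m ω) (Prod.mk (genealogy ξ I l m ω) ⁻¹' D) ∂P := by
    have h2 := congrArg (fun ν => ν D) (hF.map_genealogy_generation hm l hg hpos hN)
    beta_reduce at h2
    rw [Measure.map_apply (hθ.prodMk hY) hDm, Measure.compProd_apply hDm, lintegral_map
      (Kernel.measurable_kernel_prodMk_left hDm) hθ] at h2
    exact h2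
  have h2 : ∀ θ, K θ (Prod.mk θ ⁻¹' D) ≤ ENNReal.ofReal (v θ / ε ^ 2) := fun θ => by
    have hpr := isProbabilityMeasure_mutationLaw (M := M) hpos hN θ.1
    have h3 := mul_meas_ge_le_integral_of_nonneg
      (μ := Measure.pi fun _ : Fin N => mutationLaw M (g (z m)) θ.1)
      (Eventually.of_forall fun y => sq_nonneg (s θ y)) ((hb θ).sq.integrable _) (ε ^ 2)
    have h4 : K θ (Prod.mk θ ⁻¹' D) = (Measure.pi fun _ : Fin N => mutationLaw M (g (z m)) θ.1)
        {y | ε ^ 2 ≤ s θ y ^ 2} := by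
      rw [hK, Kernel.comap_apply, generationKernel_apply]
      congr 1
      ext y
      simp only [hD, Set.mem_preimage, Set.mem_ofPred_eq, Function.uncurry]
      rw [sq_le_sq, abs_of_pos hε]
    rw [h4, ENNReal.le_ofReal_iff_toReal_le (measure_ne_top _ _)
      (div_nonneg ((integral_nonneg fun y => sq_nonneg _).trans (hv θ)) (sq_nonneg _)),
      le_div_iff₀ (by positivity), mul_comm]
    exact h3.trans (hv θ)
  rw [h1]
  -- Where v ≥ δ the conditional probability is bounded by 1, elsewhere by Chebyshev's δ/ε². No
  -- measurability of v is needed, because only an upper bound for the integral of the indicator is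
  -- used.
  calc _ ≤ ∫⁻ ω, ({ω | δ ≤ v (genealogy ξ I l m ω)}.indicator 1 ω
        + ENNReal.ofReal (δ / ε ^ 2)) ∂P := by
        refine lintegral_mono fun ω => ?_
        by_cases h : δ ≤ v (genealogy ξ I l m ω)
        · rw [Set.indicator_of_mem (by exact h)]
          exact le_add_right (by simpa using prob_le_one)
        · refine (h2 _).trans (le_add_left (ENNReal.ofReal_le_ofReal ?_))
          gcongr
          exact (not_le.1 h).le
    _ ≤ _ := by
        rw [lintegral_add_right _ measurable_const]
        gcongr
        · exact lintegral_indicator_one_le _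
        · simp

end IsParticleFilter

end Step

/-! ### The limiting quantities -/

section Limits

variable {X Z : Type*} [MeasurableSpace X] {χ : Measure X} [IsProbabilityMeasure χ]
  {M : Kernel X X} [IsMarkovKernel M] {g : Z → X → ℝ} {z : ℕ → Z}

/-- Regularity of the potentials: measurable, positive and bounded. -/
structure IsPotential (g : Z → X → ℝ) : Prop where
  meas : ∀ z, Measurable (g z)
  pos : ∀ z x, 0 < g z x
  bdd : ∀ z, ∃ C : ℝ, ∀ x, |g z x| ≤ C

lemma IsPotential.bddMeas (hg : IsPotential g) (a : Z) : BddMeas (g a) := ⟨hg.meas a, hg.bdd a⟩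

lemma stepKernel_apply (hg : IsPotential g) (a : Z) (x : X) :
    stepKernel M g a x = ENNReal.ofReal (g a x) • M x := by
  rw [stepKernel, Kernel.withDensity_apply, withDensity_const]
  exact ((hg.meas a).comp measurable_fst).ennreal_ofReal

lemma isFiniteKernel_stepKernel (hg : IsPotential g) (a : Z) :
    IsFiniteKernel (stepKernel M g a) := by
  obtain ⟨C, hC⟩ := hg.bdd a
  refine ⟨ENNReal.ofReal C, ENNReal.ofReal_lt_top, fun x => ?_⟩
  rw [stepKernel_apply hg]
  simpa using ENNReal.ofReal_le_ofReal ((le_abs_self _).trans (hC x))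

lemma integral_stepKernel (hg : IsPotential g) (a : Z) (x : X) (f : X → ℝ) :
    ∫ y, f y ∂(stepKernel M g a x) = g a x * ∫ y, f y ∂(M x) := by
  rw [stepKernel_apply hg, integral_smul_measure, ENNReal.toReal_ofReal (hg.pos a x).le,
    smul_eq_mul]

lemma unnormKernel_self (m : ℕ) : unnormKernel M g z m m = Kernel.id := by
  cases m <;> simp [unnormKernel]

lemma unnormKernel_succ {k m : ℕ} (h : k ≤ m) :
    unnormKernel M g z k (m + 1) = stepKernel M g (z m) ∘ₖ unnormKernel M g z k m := by
  rw [unnormKernel, if_pos h]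

lemma isFiniteKernel_unnormKernel (hg : IsPotential g) (k m : ℕ) :
    IsFiniteKernel (unnormKernel M g z k m) := by
  induction m with
  | zero => rw [unnormKernel]; infer_instance
  | succ m ih =>
    have := isFiniteKernel_stepKernel (M := M) hg (z m)
    rw [unnormKernel]
    split_ifs <;> infer_instance

lemma integral_unnormKernel_self {f : X → ℝ} (hf : Measurable f) (m : ℕ) (x : X) :
    ∫ y, f y ∂(unnormKernel M g z m m x) = f x := by
  rw [unnormKernel_self, Kernel.id_apply, integral_dirac' _ _ hf.stronglyMeasurable]

lemma integral_unnormKernel_succ (hg : IsPotential g) {k m : ℕ} (h : k ≤ m) {f : X → ℝ}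
    (hf : BddMeas f) (x : X) :
    ∫ y, f y ∂(unnormKernel M g z k (m + 1) x)
      = ∫ y, g (z m) y * ∫ u, f u ∂(M y) ∂(unnormKernel M g z k m x) := by
  have := isFiniteKernel_stepKernel (M := M) hg (z m)
  have := isFiniteKernel_unnormKernel (M := M) (z := z) hg k m
  rw [unnormKernel_succ h, Kernel.integral_comp (hf.integrable _)]
  simp_rw [integral_stepKernel hg]

lemma bddMeas_step (hg : IsPotential g) (a : Z) {f : X → ℝ} (hf : BddMeas f) :
    BddMeas (fun y => g a y * ∫ u, f u ∂(M y)) :=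
  (hg.bddMeas a).mul (hf.integral_kernel M)

/-- The unnormalised flow. -/
noncomputable def unnormFlow (χ : Measure X) (M : Kernel X X) [IsMarkovKernel M] (g : Z → X → ℝ)
    (z : ℕ → Z) (n : ℕ) (f : X → ℝ) : ℝ :=
  ∫ x, ∫ y, f y ∂(unnormKernel M g z 0 n x) ∂χ

lemma integral_bind_unnormKernel (hg : IsPotential g) (n : ℕ) {f : X → ℝ} (hf : BddMeas f) :
    ∫ y, f y ∂(χ.bind (unnormKernel M g z 0 n)) = unnormFlow χ M g z n f := by
  have := isFiniteKernel_unnormKernel (M := M) (z := z) hg 0 n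
  rw [Measure.comp_eq_comp_const_apply, Kernel.integral_comp (hf.integrable _),
    Kernel.const_apply]
  rfl

omit [IsProbabilityMeasure χ] in
lemma unnormFlow_zero {f : X → ℝ} (hf : Measurable f) :
    unnormFlow χ M g z 0 f = ∫ x, f x ∂χ := by
  simp_rw [unnormFlow, integral_unnormKernel_self hf]

omit [IsProbabilityMeasure χ] in
lemma unnormFlow_succ (hg : IsPotential g) (n : ℕ) {f : X → ℝ} (hf : BddMeas f) :
    unnormFlow χ M g z (n + 1) f = unnormFlow χ M g z n (fun y => g (z n) y * ∫ u, f u ∂(M y)) := by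
  simp_rw [unnormFlow, integral_unnormKernel_succ hg (Nat.zero_le n) hf]

lemma integral_pos_of_pos {X : Type*} [MeasurableSpace X] (μ : Measure X) [IsProbabilityMeasure μ] {f : X → ℝ} (hf : BddMeas f)
    (hpos : ∀ x, 0 < f x) : 0 < ∫ x, f x ∂μ := by
  rw [integral_pos_iff_support_of_nonneg (fun x => (hpos x).le) (hf.integrable μ)]
  have : Function.support f = Set.univ := Set.eq_univ_of_forall fun x => (hpos x).ne'
  simp [this]

/-- One step of the flow replaces f by g M f, which is again positive everywhere. This makes every
normalising constant below nonzero. -/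
lemma unnormFlow_pos (hg : IsPotential g) (n : ℕ) {f : X → ℝ} (hf : BddMeas f)
    (hpos : ∀ x, 0 < f x) : 0 < unnormFlow χ M g z n f := by
  induction n generalizing f with
  | zero =>
    rw [unnormFlow_zero hf.meas]
    exact integral_pos_of_pos χ hf hpos
  | succ n ih =>
    rw [unnormFlow_succ hg n hf]
    refine ih (bddMeas_step hg _ hf) fun x => mul_pos (hg.pos _ _) ?_
    exact integral_pos_of_pos _ hf hpos

lemma integral_normalise {μ : Measure X} [IsFiniteMeasure μ] (f : X → ℝ) :
    ∫ x, f x ∂(normalise μ) = (∫ x, f x ∂μ) / ∫ _, (1 : ℝ) ∂μ := by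
  rw [normalise, integral_smul_measure, smul_eq_mul, ENNReal.toReal_inv, integral_const,
    smul_eq_mul, mul_one, div_eq_inv_mul]
  rfl

lemma integral_pred (hg : IsPotential g) (n : ℕ) {f : X → ℝ} (hf : BddMeas f) :
    ∫ x, f x ∂(pred χ M g z n)
      = unnormFlow χ M g z n f / unnormFlow χ M g z n (fun _ => 1) := by
  have := isFiniteKernel_unnormKernel (M := M) (z := z) hg 0 n
  rw [pred, integral_normalise, integral_bind_unnormKernel hg n hf,
    integral_bind_unnormKernel hg n (BddMeas.const 1)]

lemma isProbabilityMeasure_pred (hg : IsPotential g) (n : ℕ) :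
    IsProbabilityMeasure (pred χ M g z n) := by
  have := isFiniteKernel_unnormKernel (M := M) (z := z) hg 0 n
  refine ⟨?_⟩
  have h0 := unnormFlow_pos (χ := χ) (M := M) (z := z) hg n (BddMeas.const 1) fun _ => one_pos
  rw [← integral_bind_unnormKernel hg n (BddMeas.const 1), integral_const, smul_eq_mul,
    mul_one] at h0
  rw [pred, normalise, Measure.smul_apply, smul_eq_mul]
  refine ENNReal.inv_mul_cancel (fun h => ?_) (measure_ne_top _ _)
  simp [Measure.real, h] at h0

lemma integral_pred_pos (hg : IsPotential g) (n : ℕ) {f : X → ℝ} (hf : BddMeas f)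
    (hpos : ∀ x, 0 < f x) : 0 < ∫ x, f x ∂(pred χ M g z n) := by
  rw [integral_pred hg n hf]
  exact div_pos (unnormFlow_pos hg n hf hpos)
    (unnormFlow_pos hg n (BddMeas.const 1) fun _ => one_pos)

lemma integral_pred_zero {f : X → ℝ} (hg : IsPotential g) (hf : BddMeas f) :
    ∫ x, f x ∂(pred χ M g z 0) = ∫ x, f x ∂χ := by
  rw [integral_pred hg 0 hf, unnormFlow_zero hf.meas, unnormFlow_zero measurable_const]
  simp

/-- The unnormalised flow at n+1 is that at n applied to g M f, and g M 1 = g; the total mass at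
time n cancels from the quotient. -/
lemma integral_pred_succ (hg : IsPotential g) (n : ℕ) {f : X → ℝ} (hf : BddMeas f) :
    ∫ x, f x ∂(pred χ M g z (n + 1))
      = (∫ x, g (z n) x * ∫ u, f u ∂(M x) ∂(pred χ M g z n)) / ∫ x, g (z n) x ∂(pred χ M g z n) := by
  have h0 := unnormFlow_pos (χ := χ) (M := M) (z := z) hg n (BddMeas.const 1) fun _ => one_pos
  rw [integral_pred hg _ hf, integral_pred hg n (bddMeas_step hg _ hf),
    integral_pred hg n (hg.bddMeas (z n)), unnormFlow_succ hg n hf,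
    unnormFlow_succ hg n (BddMeas.const 1)]
  simp only [integral_const, probReal_univ, smul_eq_mul, mul_one]
  rw [div_div_div_cancel_right₀ h0.ne']

lemma integral_filt (hg : IsPotential g) (n : ℕ) {f : X → ℝ} (hf : BddMeas f) :
    ∫ x, f x ∂(filt χ M g z n)
      = (∫ x, g (z n) x * f x ∂(pred χ M g z n)) / ∫ x, g (z n) x ∂(pred χ M g z n) := by
  have := isFiniteKernel_unnormKernel (M := M) (z := z) hg 0 n
  have h0 := unnormFlow_pos (χ := χ) (M := M) (z := z) hg n (BddMeas.const 1) fun _ => one_pos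
  have hgb := hg.bddMeas (z n)
  set ν := χ.bind (unnormKernel M g z 0 n) with hν
  have hfin : IsFiniteMeasure (ν.withDensity fun x => ENNReal.ofReal (g (z n) x)) :=
    isFiniteMeasure_withDensity_ofReal (hgb.integrable ν).2
  have h1 : ∀ f : X → ℝ, ∫ x, f x ∂(ν.withDensity fun x => ENNReal.ofReal (g (z n) x))
      = ∫ x, g (z n) x * f x ∂ν := fun f => by
    rw [integral_withDensity_eq_integral_toReal_smul hgb.meas.ennreal_ofReal
      (Eventually.of_forall fun x => ENNReal.ofReal_lt_top)]
    simp_rw [ENNReal.toReal_ofReal (hg.pos _ _).le, smul_eq_mul]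
  rw [filt, integral_normalise, h1, h1, integral_bind_unnormKernel hg n (hgb.mul hf),
    integral_pred hg n (hgb.mul hf), integral_pred hg n hgb]
  simp_rw [mul_one]
  rw [integral_bind_unnormKernel hg n hgb, div_div_div_cancel_right₀ h0.ne']

omit [IsProbabilityMeasure χ] in
/-- The semigroup property of the unnormalised kernels, integrated against the flow. -/
lemma unnormFlow_unnormKernel (hg : IsPotential g) {m n : ℕ} (h : m ≤ n) {f : X → ℝ}
    (hf : BddMeas f) :
    unnormFlow χ M g z m (fun x => ∫ y, f y ∂(unnormKernel M g z m n x))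
      = unnormFlow χ M g z n f := by
  induction n, h using Nat.le_induction generalizing f with
  | base => simp_rw [integral_unnormKernel_self hf.meas]
  | succ n hmn ih =>
    simp_rw [integral_unnormKernel_succ hg hmn hf]
    rw [ih (bddMeas_step hg _ hf), unnormFlow_succ hg n hf]

lemma bddMeas_unnormKernel (hg : IsPotential g) (m n : ℕ) {f : X → ℝ} (hf : BddMeas f) :
    BddMeas (fun x => ∫ y, f y ∂(unnormKernel M g z m n x)) := by
  have := isFiniteKernel_unnormKernel (M := M) (z := z) hg m n
  exact hf.integral_kernel _

/-- By the semigroup property, η_m Q_{m,n} 1 is the ratio of the total masses of the unnormalised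
flow at n and at m; the masses at n+1 and at n differ by the factor η_n g. -/
lemma integral_pred_unnormKernel_one_succ (hg : IsPotential g) {m n : ℕ} (h : m ≤ n) :
    ∫ x, ∫ _, (1 : ℝ) ∂(unnormKernel M g z m (n + 1) x) ∂(pred χ M g z m)
      = (∫ x, ∫ _, (1 : ℝ) ∂(unnormKernel M g z m n x) ∂(pred χ M g z m))
        * ∫ x, g (z n) x ∂(pred χ M g z n) := by
  have b1 : BddMeas (fun _ : X => (1 : ℝ)) := BddMeas.const 1
  have h0 := unnormFlow_pos (χ := χ) (M := M) (z := z) hg n b1 fun _ => one_pos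
  have hm0 := unnormFlow_pos (χ := χ) (M := M) (z := z) hg m b1 fun _ => one_pos
  rw [integral_pred hg m (bddMeas_unnormKernel hg m (n + 1) b1),
    integral_pred hg m (bddMeas_unnormKernel hg m n b1), integral_pred hg n (hg.bddMeas (z n)),
    unnormFlow_unnormKernel hg (h.trans n.le_succ) b1, unnormFlow_unnormKernel hg h b1,
    unnormFlow_succ hg n b1]
  simp only [integral_const, probReal_univ, smul_eq_mul, mul_one]
  field_simp

/-- The asymptotic variance without centring of the test function. -/
noncomputable def asVarUncentred (χ : Measure X) (M : Kernel X X) [IsMarkovKernel M]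
    (g : Z → X → ℝ) (z : ℕ → Z) (l n : ℕ) (f : X → ℝ) : ℝ :=
  ∑ m ∈ Finset.Icc l n, (∫ x, (∫ y, f y ∂(unnormKernel M g z m n x)) ^ 2 ∂(pred χ M g z m))
      / (∫ x, (∫ _, (1 : ℝ) ∂(unnormKernel M g z m n x)) ∂(pred χ M g z m)) ^ 2

omit [IsProbabilityMeasure χ] in
lemma asVar_eq_asVarUncentred (l n : ℕ) {f : X → ℝ} (h : ∫ x, f x ∂(pred χ M g z n) = 0) :
    asVar χ M g z l n f = asVarUncentred χ M g z l n f := by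
  simp [asVar, asVarUncentred, h]

lemma asVarUncentred_self (hg : IsPotential g) (l : ℕ) {f : X → ℝ} (hf : BddMeas f) :
    asVarUncentred χ M g z l l f = ∫ x, f x ^ 2 ∂(pred χ M g z l) := by
  have := isProbabilityMeasure_pred (χ := χ) (M := M) (z := z) hg l
  simp_rw [asVarUncentred, Finset.Icc_self, Finset.sum_singleton,
    integral_unnormKernel_self hf.meas, integral_unnormKernel_self measurable_const]
  simp

/-- The recursion matched by the conditional means of the particle statistic. The top index
contributes η_{n+1} f²; at the others Q_{m,n+1} f = Q_{m,n}(g M f), and every denominator gains the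
same factor (η_n g)². -/
lemma asVarUncentred_succ (hg : IsPotential g) {l n : ℕ} (h : l ≤ n) {f : X → ℝ} (hf : BddMeas f) :
    asVarUncentred χ M g z l (n + 1) f
      = ∫ x, f x ^ 2 ∂(pred χ M g z (n + 1))
        + asVarUncentred χ M g z l n (fun x => g (z n) x * ∫ u, f u ∂(M x))
          / (∫ x, g (z n) x ∂(pred χ M g z n)) ^ 2 := by
  rw [← asVarUncentred_self hg (n + 1) hf]
  simp only [asVarUncentred, Finset.Icc_self, Finset.sum_singleton]
  rw [Finset.sum_Icc_succ_top (by omega), add_comm, Finset.sum_div]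
  congr 1
  refine Finset.sum_congr rfl fun m hm => ?_
  have hmn := (Finset.mem_Icc.1 hm).2
  rw [integral_pred_unnormKernel_one_succ hg hmn, mul_pow, div_div]
  simp_rw [integral_unnormKernel_succ hg hmn hf]

/-- The quadratic form `asVarUncentred` at `f - c f'`. -/
lemma asVarUncentred_sub_mul (hg : IsPotential g) (l n : ℕ) {f f' : X → ℝ} (hf : BddMeas f)
    (hf' : BddMeas f') (c : ℝ) :
    asVarUncentred χ M g z l n (fun x => f x - c * f' x)
      = (1 + c) * asVarUncentred χ M g z l n f
        - c * asVarUncentred χ M g z l n (fun x => f x + f' x)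
        + (c + c ^ 2) * asVarUncentred χ M g z l n f' := by
  simp only [asVarUncentred]
  rw [Finset.mul_sum, Finset.mul_sum, Finset.mul_sum, ← Finset.sum_sub_distrib,
    ← Finset.sum_add_distrib]
  refine Finset.sum_congr rfl fun m _ => ?_
  have := isFiniteKernel_unnormKernel (M := M) (z := z) hg m n
  have := isProbabilityMeasure_pred (χ := χ) (M := M) (z := z) hg m
  have b1 := bddMeas_unnormKernel (M := M) (z := z) hg m n hf
  have b2 := bddMeas_unnormKernel (M := M) (z := z) hg m n hf'
  set F := fun x => ∫ y, f y ∂(unnormKernel M g z m n x) with hF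
  set F' := fun x => ∫ y, f' y ∂(unnormKernel M g z m n x) with hF'
  have e1 : ∀ x, ∫ y, (f y - c * f' y) ∂(unnormKernel M g z m n x) = F x - c * F' x := fun x => by
    rw [integral_sub (hf.integrable _) ((hf'.const_mul c).integrable _), integral_const_mul]
  have e2 : ∀ x, ∫ y, (f y + f' y) ∂(unnormKernel M g z m n x) = F x + F' x := fun x =>
    integral_add (hf.integrable _) (hf'.integrable _)
  have e3 : ∫ x, (F x - c * F' x) ^ 2 ∂(pred χ M g z m)
      = (1 + c) * ∫ x, F x ^ 2 ∂(pred χ M g z m) - c * ∫ x, (F x + F' x) ^ 2 ∂(pred χ M g z m)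
        + (c + c ^ 2) * ∫ x, F' x ^ 2 ∂(pred χ M g z m) := by
    rw [← integral_const_mul, ← integral_const_mul, ← integral_const_mul,
      ← integral_sub ((b1.sq.const_mul _).integrable _) (((b1.add b2).sq.const_mul _).integrable _),
      ← integral_add (((b1.sq.const_mul _).sub ((b1.add b2).sq.const_mul _)).integrable _)
        ((b2.sq.const_mul _).integrable _)]
    refine integral_congr_ae (Eventually.of_forall fun x => ?_)
    beta_reduce
    ring
  simp_rw [e1, e2]
  rw [e3]
  ring

end Limits

/-! ### Convergence in probability to constants -/

section InMeasure

variable {Ω : Type*} [MeasurableSpace Ω] {P : Measure Ω} {u v : ℕ → Ω → ℝ} {a b : ℝ}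

/-- Continuous mapping theorem for convergence in measure to constants. -/
lemma tendstoInMeasure_comp₂ (F : ℝ → ℝ → ℝ) (hF : ContinuousAt (Function.uncurry F) (a, b))
    (hu : TendstoInMeasure P u atTop fun _ => a) (hv : TendstoInMeasure P v atTop fun _ => b) :
    TendstoInMeasure P (fun N ω => F (u N ω) (v N ω)) atTop fun _ => F a b := by
  rw [tendstoInMeasure_iff_dist] at hu hv ⊢
  intro ε hε
  obtain ⟨δ, hδ, h⟩ := Metric.continuousAt_iff.1 hF ε hε
  have h0 := (hu δ hδ).add (hv δ hδ)
  rw [add_zero] at h0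
  refine tendsto_of_tendsto_of_tendsto_of_le_of_le tendsto_const_nhds h0 (fun _ => zero_le)
    fun N => (measure_mono fun ω hω => ?_).trans (measure_union_le _ _)
  by_contra hcon
  simp only [Set.mem_union, Set.mem_ofPred_eq, not_or, not_le] at hcon hω
  have := h (x := (u N ω, v N ω)) (by rw [Prod.dist_eq]; exact max_lt hcon.1 hcon.2)
  exact absurd this (not_lt.2 hω)

lemma tendstoInMeasure_of_tendsto {r : ℕ → ℝ} (hr : Tendsto r atTop (nhds a)) :
    TendstoInMeasure P (fun N _ => r N) atTop fun _ => a := by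
  rw [tendstoInMeasure_iff_dist]
  intro ε hε
  refine tendsto_const_nhds.congr' ?_
  filter_upwards [Metric.tendsto_nhds.1 hr ε hε] with N this
  simp [not_le.2 this]

lemma tendstoInMeasure_add (hu : TendstoInMeasure P u atTop fun _ => a)
    (hv : TendstoInMeasure P v atTop fun _ => b) :
    TendstoInMeasure P (fun N ω => u N ω + v N ω) atTop fun _ => a + b :=
  tendstoInMeasure_comp₂ (fun x y => x + y) continuous_add.continuousAt hu hv

lemma tendstoInMeasure_sub (hu : TendstoInMeasure P u atTop fun _ => a)
    (hv : TendstoInMeasure P v atTop fun _ => b) :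
    TendstoInMeasure P (fun N ω => u N ω - v N ω) atTop fun _ => a - b :=
  tendstoInMeasure_comp₂ (fun x y => x - y) continuous_sub.continuousAt hu hv

lemma tendstoInMeasure_mul (hu : TendstoInMeasure P u atTop fun _ => a)
    (hv : TendstoInMeasure P v atTop fun _ => b) :
    TendstoInMeasure P (fun N ω => u N ω * v N ω) atTop fun _ => a * b :=
  tendstoInMeasure_comp₂ (fun x y => x * y) continuous_mul.continuousAt hu hv

lemma tendstoInMeasure_div (hu : TendstoInMeasure P u atTop fun _ => a)
    (hv : TendstoInMeasure P v atTop fun _ => b) (hb : b ≠ 0) :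
    TendstoInMeasure P (fun N ω => u N ω / v N ω) atTop fun _ => a / b :=
  tendstoInMeasure_comp₂ (fun x y => x / y)
    (ContinuousAt.div₀ continuousAt_fst continuousAt_snd hb) hu hv

lemma tendstoInMeasure_pow (hu : TendstoInMeasure P u atTop fun _ => a) (k : ℕ) :
    TendstoInMeasure P (fun N ω => u N ω ^ k) atTop fun _ => a ^ k :=
  tendstoInMeasure_comp₂ (fun x _ => x ^ k)
    (by exact (continuous_fst.pow k).continuousAt) hu hu

lemma tendstoInMeasure_congr (h : ∀ N, 1 ≤ N → ∀ ω, u N ω = v N ω)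
    (hv : TendstoInMeasure P v atTop fun _ => a) : TendstoInMeasure P u atTop fun _ => a := by
  refine hv.congr' ?_ EventuallyEq.rfl
  filter_upwards [eventually_ge_atTop 1] with N hN
  exact Eventually.of_forall fun ω => (h N hN ω).symm

/-- Turns the conditional Chebyshev inequality into convergence: v plays the role of a conditional
variance bound and need only vanish in probability, not in mean. -/
lemma tendstoInMeasure_zero_of_le (hv : TendstoInMeasure P v atTop fun _ => 0)
    (h : ∀ N, 1 ≤ N → ∀ ε δ : ℝ, 0 < ε → 0 < δ →
      P {ω | ε ≤ |u N ω|} ≤ P {ω | δ ≤ v N ω} + ENNReal.ofReal (δ / ε ^ 2)) :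
    TendstoInMeasure P u atTop fun _ => 0 := by
  rw [tendstoInMeasure_iff_dist] at hv ⊢
  intro ε hε
  rw [ENNReal.tendsto_nhds_zero]
  intro η hη
  -- The tolerance η may be infinite, so a finite r below it is used; δ = rε²/2 makes the Chebyshev
  -- term equal to r/2.
  obtain ⟨r, hr0, hrη⟩ := ENNReal.lt_iff_exists_nnreal_btwn.1 hη
  have hr0' : (0 : ℝ) < r := by exact_mod_cast hr0
  have hδ : 0 < (r : ℝ) / 2 * ε ^ 2 := by positivity
  have h1 := ENNReal.tendsto_nhds_zero.1 (hv _ hδ) (ENNReal.ofReal (r / 2))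
    (ENNReal.ofReal_pos.2 (by positivity))
  filter_upwards [h1, eventually_ge_atTop 1] with N hN1 hN
  have h2 := h N hN ε _ hε hδ
  have h3 : (r : ℝ) / 2 * ε ^ 2 / ε ^ 2 = r / 2 := by field_simp
  rw [h3] at h2
  simp only [Real.dist_eq, sub_zero] at hN1 ⊢
  calc _ ≤ _ := h2
    _ ≤ ENNReal.ofReal (r / 2) + ENNReal.ofReal (r / 2) := by
        gcongr
        refine le_trans (measure_mono ?_) hN1
        exact fun ω (hω : _ ≤ v N ω) => hω.trans (le_abs_self (v N ω))
    _ = r := by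
        rw [← ENNReal.ofReal_add (by positivity) (by positivity), add_halves,
          ENNReal.ofReal_coe_nnreal]
    _ ≤ η := hrη.le

end InMeasure

/-! ### Convergence of the particle approximations -/

section Statistics

variable {X : Type*} {N : ℕ}

/-- The normalised sum over the ancestors of the squared sums over their descendants. -/
noncomputable def lineageVar (E : Fin N → Fin N) (x : Fin N → X) (f : X → ℝ) : ℝ :=
  (1 / (N : ℝ)) * ∑ i, (∑ j ∈ Finset.univ.filter (fun j => E j = i), f (x j)) ^ 2

/-- Rests on (a - cb)² = (1 + c)a² - c(a + b)² + (c + c²)b². A random c then appears only in the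
coefficients, so convergence of the quadratic form at fixed functions is enough. -/
lemma lineageVar_sub_mul (E : Fin N → Fin N) (x : Fin N → X) (f f' : X → ℝ) (c : ℝ) :
    lineageVar E x (fun y => f y - c * f' y)
      = (1 + c) * lineageVar E x f - c * lineageVar E x (fun y => f y + f' y)
        + (c + c ^ 2) * lineageVar E x f' := by
  simp only [lineageVar, Finset.sum_sub_distrib, Finset.sum_add_distrib, ← Finset.mul_sum]
  simp only [Finset.mul_sum]
  rw [← Finset.sum_sub_distrib, ← Finset.sum_add_distrib]
  refine Finset.sum_congr rfl fun i _ => ?_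
  simp only [← Finset.mul_sum]
  ring

lemma lineageVar_of_forall_eq {E : Fin N → Fin N} (hE : ∀ i, E i = i) (x : Fin N → X)
    (f : X → ℝ) : lineageVar E x f = predPart x (fun y => f y ^ 2) := by
  simp only [lineageVar, predPart, hE]
  congr 1
  refine Finset.sum_congr rfl fun i _ => ?_
  rw [Finset.sum_filter]
  simp

lemma filtPart_eq_div (w : X → ℝ) (x : Fin N → X) (f : X → ℝ) (hN : 1 ≤ N) :
    filtPart w x f = predPart x (fun y => w y * f y) / predPart x w := by
  have hN' : (N : ℝ) ≠ 0 := by positivity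
  rw [filtPart, predPart, predPart, mul_div_mul_left _ _ (by positivity), Finset.sum_div]
  exact Finset.sum_congr rfl fun i _ => by ring

/-- The sum of the squared total weights of the classes. -/
lemma sum_sq_sum_weight (w : X → ℝ) (hw : ∀ x, 0 < w x) (E : Fin N → Fin N) (x : Fin N → X)
    (f : X → ℝ) (hN : 1 ≤ N) :
    ∑ i, (∑ k, w (x k) / (∑ l, w (x l)) * (if E k = i then f (x k) else 0)) ^ 2
      = lineageVar E x (fun y => w y * f y) / predPart x w ^ 2 / N := by
  have hN' : (N : ℝ) ≠ 0 := by positivity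
  have hW := (sum_weight_pos hw hN x).ne'
  simp only [lineageVar, predPart, Finset.sum_filter]
  have h1 : ∀ i, (∑ k, w (x k) / (∑ l, w (x l)) * (if E k = i then f (x k) else 0))
      = (∑ k, if E k = i then w (x k) * f (x k) else 0) / ∑ l, w (x l) := fun i => by
    rw [Finset.sum_div]
    exact Finset.sum_congr rfl fun k _ => by split_ifs <;> ring
  simp_rw [h1, div_pow]
  rw [← Finset.sum_div]
  field_simp

variable [MeasurableSpace X]

lemma measurable_predPart {f : X → ℝ} (hf : Measurable f) :
    Measurable (fun x : Fin N → X => predPart x f) :=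
  (Finset.measurable_sum _ fun i _ => hf.comp (measurable_pi_apply i)).const_mul _

lemma measurable_lineageVar {f : X → ℝ} (hf : Measurable f) :
    Measurable (fun θ : (Fin N → X) × (Fin N → Fin N) => lineageVar θ.2 θ.1 f) := by
  simp only [lineageVar, Finset.sum_filter]
  refine (Finset.measurable_sum _ fun i _ => (Finset.measurable_sum _ fun j _ =>
    Measurable.ite ?_ ?_ measurable_const).pow_const 2).const_mul _
  · have h1 : Measurable (fun θ : (Fin N → X) × (Fin N → Fin N) => θ.2 j) := by fun_prop
    exact h1 (measurableSet_singleton i)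
  · exact hf.comp ((measurable_pi_apply j).comp measurable_fst)

lemma measurable_lineageVar_comp {f : X → ℝ} (hf : Measurable f) :
    Measurable (fun p : ((Fin N → X) × (Fin N → Fin N)) × (Fin N → Fin N × X) =>
      lineageVar (fun j => p.1.2 (p.2 j).1) (fun j => (p.2 j).2) f) := by
  have h1 : Measurable (fun q : (Fin N → Fin N) × Fin N => q.1 q.2) := measurable_of_countable _
  have hp : ∀ j, Measurable (fun p : ((Fin N → X) × (Fin N → Fin N)) × (Fin N → Fin N × X) =>
      p.2 j) := fun j => (measurable_pi_apply j).comp measurable_snd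
  have hE : Measurable (fun p : ((Fin N → X) × (Fin N → Fin N)) × (Fin N → Fin N × X) => p.1.2) :=
    measurable_snd.comp measurable_fst
  simp only [lineageVar, Finset.sum_filter]
  refine (Finset.measurable_sum _ fun i _ => (Finset.measurable_sum _ fun j _ =>
    Measurable.ite ?_ ?_ measurable_const).pow_const 2).const_mul _
  · exact (h1.comp (hE.prodMk (measurable_fst.comp (hp j)))) (measurableSet_singleton i)
  · exact hf.comp (measurable_snd.comp (hp j))

lemma bddMeas_lineageVar_comp {f : X → ℝ} (hf : BddMeas f) (E : Fin N → Fin N) :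
    BddMeas (fun y : Fin N → Fin N × X =>
      lineageVar (fun j => E (y j).1) (fun j => (y j).2) f) := by
  simp only [lineageVar, Finset.sum_filter]
  refine (BddMeas.sum fun i => (BddMeas.sum fun j => ?_).sq).const_mul _
  refine BddMeas.ite (f := fun y : Fin N → Fin N × X => f (y j).2)
    (s := {y : Fin N → Fin N × X | E (y j).1 = i})
    (hf.comp (u := fun y : Fin N → Fin N × X => (y j).2) (by fun_prop)) ?_
  have he : Measurable (fun p : Fin N × X => E p.1) :=
    measurable_from_top.comp measurable_fst
  exact (he.comp (measurable_pi_apply j)) (measurableSet_singleton i)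

end Statistics

/-! ### Law of large numbers and induction over the generations. -/

section Convergence

variable {X Z Ω : Type*} [MeasurableSpace X] [MeasurableSpace Ω] {P : Measure Ω}
  [IsProbabilityMeasure P] {χ : Measure X} [IsProbabilityMeasure χ] {M : Kernel X X}
  [IsMarkovKernel M] {g : Z → X → ℝ} {z : ℕ → Z} {T : ℕ}

omit [IsMarkovKernel M] in
-- Chebyshev's inequality for the initial sample. The event on the right is deterministic; the form
-- is the one required by `tendstoInMeasure_zero_of_le`.
lemma IsParticleFilter.measure_initial_ge_le {N : ℕ} {ξ : ℕ → Ω → Fin N → X}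
    {I : ℕ → Ω → Fin N → Fin N} (hF : IsParticleFilter P χ M g z T ξ I) (hN : 1 ≤ N) {f : X → ℝ}
    (hf : BddMeas f) {ε δ : ℝ} (hε : 0 < ε) :
    P {ω | ε ≤ |predPart (ξ 0 ω) f - ∫ x, f x ∂χ|}
      ≤ P {_ω | δ ≤ (1 / (N : ℝ)) * ∫ x, f x ^ 2 ∂χ} + ENNReal.ofReal (δ / ε ^ 2) := by
  by_cases hδ : δ ≤ (1 / (N : ℝ)) * ∫ x, f x ^ 2 ∂χ
  · refine le_add_right ?_
    simp only [hδ, Set.ofPred_true, measure_univ]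
    exact prob_le_one
  refine le_add_left ?_
  have hξ := hF.measurable_particle 0 (Nat.zero_le _)
  have hb : BddMeas (fun x : Fin N → X => predPart x f - ∫ x, f x ∂χ) :=
    ((BddMeas.sum fun j => hf.comp (measurable_pi_apply j)).const_mul _).sub (BddMeas.const _)
  have hm : MeasurableSet {x : Fin N → X | ε ^ 2 ≤ (predPart x f - ∫ x, f x ∂χ) ^ 2} :=
    measurableSet_le measurable_const hb.sq.meas
  have h1 : {ω | ε ≤ |predPart (ξ 0 ω) f - ∫ x, f x ∂χ|}
      = ξ 0 ⁻¹' {x : Fin N → X | ε ^ 2 ≤ (predPart x f - ∫ x, f x ∂χ) ^ 2} := by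
    ext ω
    simp only [Set.mem_preimage, Set.mem_ofPred_eq]
    rw [sq_le_sq, abs_of_pos hε]
  rw [h1, ← Measure.map_apply hξ hm, hF.initial,
    ENNReal.le_ofReal_iff_toReal_le (measure_ne_top _ _), le_div_iff₀ (by positivity), mul_comm]
  · refine (mul_meas_ge_le_integral_of_nonneg (Eventually.of_forall fun y => sq_nonneg _)
      (hb.sq.integrable _) (ε ^ 2)).trans ?_
    exact (integral_mean_sub_sq_le (μ := χ) hf hN).trans (not_le.1 hδ).le
  · refine div_nonneg (le_trans ?_ (not_le.1 hδ).le) (sq_nonneg _)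
    exact mul_nonneg (by positivity) (integral_nonneg fun x => sq_nonneg _)

variable {ξ : (N : ℕ) → ℕ → Ω → Fin N → X} {I : (N : ℕ) → ℕ → Ω → Fin N → Fin N}

lemma tendsto_one_div_mul (c : ℝ) : Tendsto (fun N : ℕ => (1 / (N : ℝ)) * c) atTop (nhds 0) := by
  simpa using tendsto_one_div_atTop_nhds_zero_nat.mul_const c

/-- The law of large numbers for the particle filter. -/
theorem tendstoInMeasure_predPart (hg : IsPotential g)
    (hF : ∀ N, 1 ≤ N → IsParticleFilter P χ M g z T (ξ N) (I N)) {m : ℕ} (hm : m ≤ T)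
    {f : X → ℝ} (hf : BddMeas f) :
    TendstoInMeasure P (fun N ω => predPart (ξ N m ω) f) atTop
      fun _ => ∫ x, f x ∂(pred χ M g z m) := by
  induction m generalizing f with
  | zero =>
    rw [integral_pred_zero hg hf]
    have h1 : TendstoInMeasure P (fun N ω => predPart (ξ N 0 ω) f - ∫ x, f x ∂χ) atTop
        fun _ => 0 :=
      tendstoInMeasure_zero_of_le
        (tendstoInMeasure_of_tendsto (tendsto_one_div_mul (∫ x, f x ^ 2 ∂χ)))
        fun N hN ε δ hε _ => (hF N hN).measure_initial_ge_le hN hf hε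
    simpa using tendstoInMeasure_add h1
      (tendstoInMeasure_of_tendsto (tendsto_const_nhds (x := ∫ x, f x ∂χ)))
  | succ m ih =>
    have hmT : m < T := hm
    have bM : BddMeas (fun y => ∫ u, f u ∂(M y)) := hf.integral_kernel M
    rw [integral_pred_succ hg m hf]
    obtain ⟨C, hC⟩ := hf.bdd
    set w := g (z m) with hw
    -- Given generation m, the new particles are i.i.d. and the mean of f under their common law is
    -- the weighted average of M f; the conditional variance of the empirical mean is at most C²/N.
    have hcond : TendstoInMeasure P (fun N ω => predPart (ξ N (m + 1) ω) f
        - filtPart w (ξ N m ω) fun y => ∫ u, f u ∂(M y)) atTop fun _ => 0 := by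
      refine tendstoInMeasure_zero_of_le (tendstoInMeasure_of_tendsto (tendsto_one_div_mul (C ^ 2)))
        fun N hN ε δ hε _ => ?_
      have bmean : BddMeas (fun y : Fin N → Fin N × X => (1 / (N : ℝ)) * ∑ j, f (y j).2) :=
        (BddMeas.sum fun j => hf.comp (u := fun y : Fin N → Fin N × X => (y j).2)
          (by fun_prop)).const_mul _
      have mf : Measurable fun x : Fin N → X => filtPart w x fun y => ∫ u, f u ∂(M y) := by
        simp_rw [fun x : Fin N → X => filtPart_eq_div w x (fun y => ∫ u, f u ∂(M y)) hN]
        exact (measurable_predPart ((hg.meas _).mul bM.meas)).div (measurable_predPart (hg.meas _))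
      -- The ancestral time 0 is an arbitrary choice: the statistic does not involve the ancestors.
      refine (hF N hN).measure_ge_le hmT 0 (hg.meas _) (hg.pos _) hN
        (s := fun θ y => (1 / (N : ℝ)) * ∑ j, f (y j).2
          - filtPart w θ.1 fun y => ∫ u, f u ∂(M y))
        (v := fun _ => (1 / (N : ℝ)) * C ^ 2) ?_ ?_ ?_ hε
      · exact (bmean.meas.comp measurable_snd).sub
          (mf.comp (measurable_fst.comp measurable_fst))
      · exact fun θ => bmean.sub (BddMeas.const _)
      · intro θ
        have hpr := isProbabilityMeasure_mutationLaw (M := M) (hg.pos (z m)) hN θ.1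
        have bf2 : BddMeas (fun p : Fin N × X => f p.2) := hf.comp measurable_snd
        have h2 := integral_mean_sub_sq_le (μ := mutationLaw M w θ.1) bf2 hN
        rw [integral_mutationLaw (hg.pos (z m)) θ.1 bf2] at h2
        refine h2.trans (mul_le_mul_of_nonneg_left ?_ (by positivity))
        have h3 : ∫ _, C ^ 2 ∂(mutationLaw M w θ.1) = C ^ 2 := by simp
        rw [← h3]
        exact integral_mono (bf2.sq.integrable _) (integrable_const _) fun p =>
          sq_le_sq.2 ((hC _).trans (le_abs_self C))
    have hfilt : TendstoInMeasure P
        (fun N ω => filtPart w (ξ N m ω) fun y => ∫ u, f u ∂(M y)) atTop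
        fun _ => (∫ x, w x * ∫ u, f u ∂(M x) ∂(pred χ M g z m)) / ∫ x, w x ∂(pred χ M g z m) :=
      tendstoInMeasure_congr (fun _ hN _ => filtPart_eq_div _ _ _ hN)
        (tendstoInMeasure_div (ih hmT.le ((hg.bddMeas _).mul bM)) (ih hmT.le (hg.bddMeas _))
          (integral_pred_pos hg m (hg.bddMeas _) (hg.pos _)).ne')
    simpa using tendstoInMeasure_add hcond hfilt

lemma tendstoInMeasure_filtPart (hg : IsPotential g)
    (hF : ∀ N, 1 ≤ N → IsParticleFilter P χ M g z T (ξ N) (I N)) {m : ℕ} (hm : m ≤ T)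
    {f : X → ℝ} (hf : BddMeas f) :
    TendstoInMeasure P (fun N ω => filtPart (g (z m)) (ξ N m ω) f) atTop
      fun _ => (∫ x, g (z m) x * f x ∂(pred χ M g z m)) / ∫ x, g (z m) x ∂(pred χ M g z m) :=
  tendstoInMeasure_congr (fun _ hN _ => filtPart_eq_div _ _ _ hN)
    (tendstoInMeasure_div (tendstoInMeasure_predPart hg hF hm ((hg.bddMeas _).mul hf))
      (tendstoInMeasure_predPart hg hF hm (hg.bddMeas _))
      (integral_pred_pos hg m (hg.bddMeas _) (hg.pos _)).ne')

/-- The conditional mean of the lineage statistic of the next generation. -/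
noncomputable def lineageMean {N : ℕ} (M : Kernel X X) (w : X → ℝ) (f : X → ℝ)
    (θ : (Fin N → X) × (Fin N → Fin N)) : ℝ :=
  filtPart w θ.1 (fun y => ∫ u, f u ^ 2 ∂(M y))
    + (1 - 1 / (N : ℝ)) * (lineageVar θ.2 θ.1 (fun y => w y * ∫ u, f u ∂(M y))
      / predPart θ.1 w ^ 2)

lemma measurable_lineageMean {N : ℕ} {w f : X → ℝ} (hw : Measurable w) (hf : BddMeas f)
    (hN : 1 ≤ N) :
    Measurable (fun θ : (Fin N → X) × (Fin N → Fin N) => lineageMean M w f θ) := by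
  have bM : BddMeas (fun y => ∫ u, f u ∂(M y)) := hf.integral_kernel M
  have bM2 : BddMeas (fun y => ∫ u, f u ^ 2 ∂(M y)) := hf.sq.integral_kernel M
  unfold lineageMean
  simp_rw [fun x : Fin N → X => filtPart_eq_div w x (fun y => ∫ u, f u ^ 2 ∂(M y)) hN]
  have m1 : Measurable (fun θ : (Fin N → X) × (Fin N → Fin N) => predPart θ.1 w) :=
    (measurable_predPart hw).comp measurable_fst
  have m2 : Measurable (fun θ : (Fin N → X) × (Fin N → Fin N) =>
      predPart θ.1 fun y => w y * ∫ u, f u ^ 2 ∂(M y)) :=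
    (measurable_predPart (hw.mul bM2.meas)).comp measurable_fst
  exact (m2.div m1).add (((measurable_lineageVar (hw.mul bM.meas)).div
    (m1.pow_const 2)).const_mul _)

/-- A bound for the conditional variance of the lineage statistic of the next generation. -/
noncomputable def lineageBound {N : ℕ} (w : X → ℝ) (C : ℝ)
    (θ : (Fin N → X) × (Fin N → Fin N)) : ℝ :=
  C ^ 4 * (12 * (1 / (N : ℝ))
    + 24 * (√(lineageVar θ.2 θ.1 w / predPart θ.1 w ^ 2 * (1 / (N : ℝ)))
      * (lineageVar θ.2 θ.1 w / predPart θ.1 w ^ 2))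
    + 8 * (lineageVar θ.2 θ.1 w / predPart θ.1 w ^ 2 * (1 / (N : ℝ))))

/-- Two new particles lie in the same class when their parents have the same ancestor, so the class
masses are the normalised total weights of the families. Their sum of squares Q is the lineage
statistic of w one generation earlier, divided by N and by the squared mean weight; in N√Q·Q the
factor N cancels one 1/N, which gives `lineageBound`. -/
lemma integral_lineageVar_sub_sq_le {N : ℕ} {w : X → ℝ} (hw : ∀ x, 0 < w x)
    {f : X → ℝ} (hf : Measurable f) {C : ℝ} (hC : ∀ x, |f x| ≤ C) (hN : 1 ≤ N)
    (θ : (Fin N → X) × (Fin N → Fin N)) :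
    ∫ y, (lineageVar (fun j => θ.2 (y j).1) (fun j => (y j).2) f - lineageMean M w f θ) ^ 2
        ∂(Measure.pi fun _ : Fin N => mutationLaw M w θ.1) ≤ lineageBound w C θ := by
  have hN' : (N : ℝ) ≠ 0 := by positivity
  have hpr := isProbabilityMeasure_mutationLaw (M := M) hw hN θ.1
  have bf : BddMeas f := ⟨hf, C, hC⟩
  have he : Measurable (fun p : Fin N × X => θ.2 p.1) := measurable_from_top.comp measurable_fst
  have hcl : ∀ {f' : X → ℝ}, BddMeas f' → ∀ i, ∫ p, (if θ.2 p.1 = i then f' p.2 else 0)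
      ∂(mutationLaw M w θ.1)
        = ∑ k, w (θ.1 k) / (∑ l, w (θ.1 l)) * (if θ.2 k = i then ∫ u, f' u ∂(M (θ.1 k)) else 0) :=
    fun {f'} bf' i => by
      have b : BddMeas (fun p : Fin N × X => if θ.2 p.1 = i then f' p.2 else 0) :=
        (bf'.comp measurable_snd).ite (s := {p : Fin N × X | θ.2 p.1 = i})
          (he (measurableSet_singleton i))
      rw [integral_mutationLaw hw θ.1 b]
      refine Finset.sum_congr rfl fun k _ => ?_
      dsimp only
      split_ifs <;> simp
  have hQ : lineageVar θ.2 θ.1 w / predPart θ.1 w ^ 2 * (1 / (N : ℝ))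
      = ∑ i, (∫ p, (if θ.2 p.1 = i then (1 : ℝ) else 0) ∂(mutationLaw M w θ.1)) ^ 2 := by
    simp_rw [hcl (BddMeas.const 1)]
    have := sum_sq_sum_weight w hw θ.2 θ.1 (fun _ => 1) hN
    simp only [mul_one] at this
    rw [mul_one_div, ← this]
    simp
  have hmain := integral_classSum_sub_sq_le (μ := mutationLaw M w θ.1) he
    (hf.comp measurable_snd) (fun p => hC p.2) hN hQ
  -- The N - 1 off-diagonal partners meet the 1/N of `sum_sq_sum_weight`, whence the factor 1 - 1/N.
  have hmean : ∫ p, (f ∘ Prod.snd) p ^ 2 ∂(mutationLaw M w θ.1) + ((N : ℝ) - 1)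
      * ∑ i, (∫ p, (if θ.2 p.1 = i then (f ∘ Prod.snd) p else 0) ∂(mutationLaw M w θ.1)) ^ 2
      = lineageMean M w f θ := by
    have b2 : BddMeas (fun p : Fin N × X => f p.2 ^ 2) := bf.sq.comp measurable_snd
    simp only [Function.comp]
    simp_rw [hcl bf]
    rw [integral_mutationLaw hw θ.1 b2,
      sum_sq_sum_weight w hw θ.2 θ.1 (fun y => ∫ u, f u ∂(M y)) hN, lineageMean, filtPart]
    field_simp
  rw [hmean] at hmain
  refine hmain.trans (le_of_eq ?_)
  rw [lineageBound]
  field_simp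

/-- Convergence of the lineage statistic with a fixed ancestral time. -/
theorem tendstoInMeasure_lineageVar (hg : IsPotential g)
    (hF : ∀ N, 1 ≤ N → IsParticleFilter P χ M g z T (ξ N) (I N)) {l m : ℕ} (hl : l ≤ m)
    (hm : m ≤ T) {f : X → ℝ} (hf : BddMeas f) :
    TendstoInMeasure P
      (fun N ω => lineageVar (enoch (fun k => I N k ω) l m) (ξ N m ω) f) atTop
      fun _ => asVarUncentred χ M g z l m f := by
  induction m, hl using Nat.le_induction generalizing f with
  | base =>
    rw [asVarUncentred_self hg l hf]
    exact tendstoInMeasure_congr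
      (fun N _ ω => lineageVar_of_forall_eq (fun i => enoch_self _ _ i) _ _)
      (tendstoInMeasure_predPart hg hF hm hf.sq)
  | succ m hlm ih =>
    have hmT : m < T := hm
    obtain ⟨C, hC⟩ := hf.bdd
    have bM : BddMeas (fun y => ∫ u, f u ∂(M y)) := hf.integral_kernel M
    have bM2 : BddMeas (fun y => ∫ u, f u ^ 2 ∂(M y)) := hf.sq.integral_kernel M
    have bw : BddMeas (g (z m)) := hg.bddMeas _
    have hη : (∫ x, g (z m) x ∂(pred χ M g z m)) ^ 2 ≠ 0 :=
      pow_ne_zero 2 (integral_pred_pos hg m bw (hg.pos _)).ne'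
    have hpw := tendstoInMeasure_pow (tendstoInMeasure_predPart hg hF hmT.le bw) 2
    have hr : TendstoInMeasure P (fun (N : ℕ) (_ : Ω) => 1 / (N : ℝ)) atTop fun _ => 0 :=
      tendstoInMeasure_of_tendsto tendsto_one_div_atTop_nhds_zero_nat
    have hone : TendstoInMeasure P (fun (_ : ℕ) (_ : Ω) => (1 : ℝ)) atTop fun _ => 1 :=
      tendstoInMeasure_of_tendsto tendsto_const_nhds
    have hbound : TendstoInMeasure P
        (fun N ω => lineageBound (g (z m)) C (genealogy (ξ N) (I N) l m ω)) atTop fun _ => 0 := by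
      -- The bound is a continuous function of U, which converges by the induction hypothesis at the
      -- potential, and of r = 1/N; it vanishes at r = 0.
      have hU := tendstoInMeasure_div (ih hmT.le bw) hpw hη
      have := tendstoInMeasure_comp₂
        (fun U r => C ^ 4 * (12 * r + 24 * (√(U * r) * U) + 8 * (U * r)))
        (Continuous.continuousAt (by simp only [Function.uncurry_def]; fun_prop)) hU hr
      have h0 : C ^ 4 * (12 * 0 + 24 * (√(asVarUncentred χ M g z l m (g (z m))
          / (∫ x, g (z m) x ∂(pred χ M g z m)) ^ 2 * 0) * (asVarUncentred χ M g z l m (g (z m))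
          / (∫ x, g (z m) x ∂(pred χ M g z m)) ^ 2)) + 8 * (asVarUncentred χ M g z l m (g (z m))
          / (∫ x, g (z m) x ∂(pred χ M g z m)) ^ 2 * 0)) = 0 := by simp
      rw [h0] at this
      exact this
    have hmean : TendstoInMeasure P
        (fun N ω => lineageMean M (g (z m)) f (genealogy (ξ N) (I N) l m ω)) atTop
        fun _ => asVarUncentred χ M g z l (m + 1) f := by
      rw [asVarUncentred_succ hg hlm hf, integral_pred_succ hg m hf.sq]
      have := tendstoInMeasure_add (tendstoInMeasure_filtPart hg hF hmT.le bM2)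
        (tendstoInMeasure_mul (tendstoInMeasure_sub hone hr)
          (tendstoInMeasure_div (ih hmT.le (bw.mul bM)) hpw hη))
      rw [sub_zero, one_mul] at this
      exact this
    have hcond : TendstoInMeasure P
        (fun N ω => lineageVar (enoch (fun k => I N k ω) l (m + 1)) (ξ N (m + 1) ω) f
          - lineageMean M (g (z m)) f (genealogy (ξ N) (I N) l m ω)) atTop fun _ => 0 := by
      refine tendstoInMeasure_zero_of_le hbound fun N hN ε δ hε _ => ?_
      -- The ancestor at time l of a new particle is that of its parent, so the statistic depends
      -- only on the genealogy at m and on generation m+1.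
      have hE : ∀ ω, enoch (fun k => I N k ω) l (m + 1)
          = fun j => enoch (fun k => I N k ω) l m (I N (m + 1) ω j) := fun ω =>
        funext fun j => enoch_succ _ hlm j
      have key := (hF N hN).measure_ge_le hmT l (hg.meas _) (hg.pos _) hN
        (s := fun θ y => lineageVar (fun j => θ.2 (y j).1) (fun j => (y j).2) f
          - lineageMean M (g (z m)) f θ) (v := lineageBound (g (z m)) C)
        ((measurable_lineageVar_comp hf.meas).sub
          ((measurable_lineageMean (hg.meas _) hf hN).comp measurable_fst))
        (fun θ => (bddMeas_lineageVar_comp hf θ.2).sub (BddMeas.const _))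
        (integral_lineageVar_sub_sq_le (hg.pos _) hf.meas hC hN) (δ := δ) hε
      simp only [hE]
      exact key
    simpa using tendstoInMeasure_add hcond hmean

end Convergence

/-! ### The estimator for the updated flow as a lineage statistic. -/

section Updated

variable {X : Type*} {N : ℕ}

lemma predPart_mul_sub_filtPart {w : X → ℝ} (hw : ∀ x, 0 < w x) (hN : 1 ≤ N) (x : Fin N → X)
    (h : X → ℝ) : predPart x (fun y => w y * (h y - filtPart w x h)) = 0 := by
  have hW := (sum_weight_pos hw hN x).ne'
  have h1 : filtPart w x h * ∑ l, w (x l) = ∑ i, w (x i) * h (x i) := by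
    rw [filtPart, Finset.sum_mul]
    exact Finset.sum_congr rfl fun i _ => by field_simp
  simp only [predPart, mul_sub, Finset.sum_sub_distrib, ← Finset.sum_mul]
  rw [← h1]
  ring

/-- The function w(h - φ^N h) has empirical mean zero, so the inner centring of the estimator
disappears. -/
lemma varEstFilt_eq {w : X → ℝ} (hw : ∀ x, 0 < w x) (hN : 1 ≤ N) (J : ℕ → Fin N → Fin N)
    (n lag : ℕ) (x : Fin N → X) (h : X → ℝ) :
    varEstFilt w J n lag x h
      = lineageVar (enoch J (n - lag) n) x (fun y => w y * h y - filtPart w x h * w y)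
        / predPart x w ^ 2 := by
  rw [varEstFilt, varEst, predPart_mul_sub_filtPart hw hN, lineageVar]
  simp only [sub_zero, mul_sub, mul_comm]

end Updated

end FeynmanKac

theorem proposition2 {X Z Ω : Type*} [MeasurableSpace X] [MeasurableSpace Ω]
    (P : Measure Ω) [IsProbabilityMeasure P]
    (χ : Measure X) [IsProbabilityMeasure χ]
    (M : Kernel X X) [IsMarkovKernel M]
    (g : Z → X → ℝ)
    (hg_meas : ∀ z, Measurable (g z))
    (hg_pos : ∀ z x, 0 < g z x)
    (hg_bdd : ∀ z, ∃ C : ℝ, ∀ x, |g z x| ≤ C)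
    (n : ℕ) (z : ℕ → Z) (lag : ℕ)
    (h : X → ℝ) (h_meas : Measurable h) (h_bdd : ∃ C : ℝ, ∀ x, |h x| ≤ C)
    (ξ : (N : ℕ) → ℕ → Ω → Fin N → X)
    (I : (N : ℕ) → ℕ → Ω → Fin N → Fin N)
    (hfilter : ∀ N : ℕ, 1 ≤ N → FeynmanKac.IsParticleFilter P χ M g z n (ξ N) (I N)) :
    TendstoInMeasure P
      (fun (N : ℕ) (ω : Ω) =>
        FeynmanKac.varEstFilt (g (z n)) (fun m => I N m ω) n lag (ξ N n ω) h)
      atTop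
      (fun _ => FeynmanKac.asVarFilt χ M g z (n - lag) n h) := by
  open FeynmanKac in
  have hg : IsPotential g := ⟨hg_meas, hg_pos, hg_bdd⟩
  have bh : BddMeas h := ⟨h_meas, h_bdd⟩
  have bw := hg.bddMeas (z n)
  have := isProbabilityMeasure_pred (χ := χ) (M := M) (z := z) hg n
  have hη := (integral_pred_pos (χ := χ) (M := M) (z := z) hg n bw (hg_pos (z n))).ne'
  set w := g (z n) with hw
  set c := ∫ u, h u ∂(filt χ M g z n) with hc
  -- The limiting counterpart of the vanishing empirical mean: w(h - c) is centred under η_n, so the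
  -- centring in `asVar` can be dropped.
  have hcη : c * ∫ x, w x ∂(pred χ M g z n) = ∫ x, w x * h x ∂(pred χ M g z n) := by
    rw [hc, integral_filt hg n bh, div_mul_cancel₀ _ hη]
  have hlim : asVarFilt χ M g z (n - lag) n h
      = ((1 + c) * asVarUncentred χ M g z (n - lag) n (fun x => w x * h x)
        - c * asVarUncentred χ M g z (n - lag) n (fun x => w x * h x + w x)
        + (c + c ^ 2) * asVarUncentred χ M g z (n - lag) n w)
          / (∫ x, w x ∂(pred χ M g z n)) ^ 2 := by
    have e1 : (fun x => w x * (h x - c)) = fun x => w x * h x - c * w x := by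
      funext x; ring
    rw [asVarFilt, ← hc, ← hw, e1, asVar_eq_asVarUncentred,
      asVarUncentred_sub_mul hg _ _ (bw.mul bh) bw]
    rw [integral_sub ((bw.mul bh).integrable _) ((bw.const_mul c).integrable _),
      integral_const_mul, hcη, sub_self]
  rw [hlim]
  have hcN : TendstoInMeasure P (fun N ω => filtPart w (ξ N n ω) h) atTop fun _ => c := by
    rw [hc, integral_filt hg n bh]
    exact tendstoInMeasure_filtPart hg hfilter le_rfl bh
  have hL := fun {f : X → ℝ} (hf : BddMeas f) =>
    tendstoInMeasure_lineageVar hg hfilter (Nat.sub_le n lag) le_rfl hf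
  have hone : TendstoInMeasure P (fun (_ : ℕ) (_ : Ω) => (1 : ℝ)) atTop fun _ => 1 :=
    tendstoInMeasure_of_tendsto tendsto_const_nhds
  -- The estimator has the same expansion as the limit in `hlim`, with c replaced by its particle
  -- estimate, which converges to c by `hcN`.
  refine tendstoInMeasure_congr (fun N hN ω => ?_) (tendstoInMeasure_div
    (tendstoInMeasure_add (tendstoInMeasure_sub
      (tendstoInMeasure_mul (tendstoInMeasure_add hone hcN) (hL (bw.mul bh)))
      (tendstoInMeasure_mul hcN (hL ((bw.mul bh).add bw))))
      (tendstoInMeasure_mul (tendstoInMeasure_add hcN (tendstoInMeasure_pow hcN 2)) (hL bw)))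
    (tendstoInMeasure_pow (tendstoInMeasure_predPart hg hfilter le_rfl bw) 2)
    (pow_ne_zero 2 hη))
  rw [varEstFilt_eq (hg_pos (z n)) hN, lineageVar_sub_mul]
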